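/- Let $f$ be a transcendental entire function, let $U$ be a simply connected wandering domain of $f$ (a simply connected component of the Fatou set of $f$ that is neither periodic nor preperiodic), and for $n\ge 0$ let $U_n$ be the Fatou component containing $f^n(U)$. Write $\operatorname{dist}_{U_n}$ for the hyperbolic distance in $U_n$, and let $$E=\{(z,z')\in U\times U : f^k(z)=f^k(z')\ \text{for some } k\in\mathbb N\}.$$ For $z,z'\in U$ let $c(z,z')=\lim_{n\to\infty}\operatorname{dist}_{U_n}(f^n(z),f^n(z'))$. Then exactly one of the following holds: (1) $U$ is contracting: $\operatorname{dist}_{U_n}(f^n(z),f^n(z'))\to c(z,z')=0$ as $n\to\infty$, for all $z,z'\in U$; (2) $U$ is semi-contracting: $\operatorname{dist}_{U_n}(f^n(z),f^n(z'))\to c(z,z')>0$ as $n\to\infty$ and $\operatorname{dist}_{U_n}(f^n(z),f^n(z'))\ne c(z,z')$ for all $n\ge 0$, for all $(z,z')\in (U\times U)\setminus E$; (3) $U$ is eventually isometric: there exists $N>0$ such that for all $n\ge N$ and all $(z,z')\in (U\times U)\setminus E$, $\operatorname{dist}_{U_n}(f^n(z),f^n(z'))=c(z,z')>0$. Moreover,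 for every $z\in U$ and $n\ge 0$ let $\lambda_n(z)$ be the hyperbolic distortion of $f:U_n\to U_{n+1}$ at $f^n(z)$, that is, $$\lambda_n(z)=\lim_{w\to f^n(z)}\frac{\operatorname{dist}_{U_{n+1}}(f(w),f(f^n(z)))}{\operatorname{dist}_{U_n}(w,f^n(z))}$$ (this limit exists). Then, for every $z\in U$, $U$ is contracting if and only if $\sum_{n=0}^{\infty}(1-\lambda_n(z))=\infty$, and $U$ is eventually isometric if and only if $\lambda_n(z)=1$ for all sufficiently large $n$. -/

import Mathlib

open Set Filter Topology

noncomputable section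

/-- A transcendental entire function: holomorphic on the whole plane and not a polynomial. -/
def IsTranscendentalEntire (f : ℂ → ℂ) : Prop :=
  Differentiable ℂ f ∧ ¬ ∃ p : Polynomial ℂ, ∀ z, f z = p.eval z

/-- Locally uniform convergence to the point at infinity on `D`. -/
def TendstoInftyLocallyUniformlyOn (F : ℕ → ℂ → ℂ) (D : Set ℂ) : Prop :=
  ∀ K ⊆ D, IsCompact K → ∀ M : ℝ, ∀ᶠ k in atTop, ∀ z ∈ K, M < ‖F k z‖

/-- The iterates of `f` form a normal family on `D`: every sequence of iterates has a subsequence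
that converges locally uniformly on `D`, either to a finite function or to infinity.
(This is used for discs `D` only, where a spherical limit is either finite everywhere or
identically infinite.) -/
def IteratesNormalOn (f : ℂ → ℂ) (D : Set ℂ) : Prop :=
  ∀ u : ℕ → ℕ, ∃ φ : ℕ → ℕ, StrictMono φ ∧
    ((∃ g : ℂ → ℂ, TendstoLocallyUniformlyOn (fun k => f^[u (φ k)]) g atTop D) ∨
      TendstoInftyLocallyUniformlyOn (fun k => f^[u (φ k)]) D)

/-- The Fatou set: the points with a neighbourhood on which the iterates form a normal family. -/
def fatouSet (f : ℂ → ℂ) : Set ℂ :=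
  {z | ∃ r > 0, IteratesNormalOn f (Metric.ball z r)}

/-- A Fatou component: a connected component of the Fatou set. -/
def IsFatouComponent (f : ℂ → ℂ) (U : Set ℂ) : Prop :=
  ∃ z ∈ fatouSet f, U = connectedComponentIn (fatouSet f) z

/-- For a Fatou component `U`, the Fatou component `U_n` that contains `f^n(U)`, written as the
union of the components of the Fatou set through the points of `f^n(U)`. These components are all
the same, because `f^n(U)` is a connected subset of the Fatou set. -/
def fatouImage (f : ℂ → ℂ) (U : Set ℂ) (n : ℕ) : Set ℂ :=
  ⋃ z ∈ U, connectedComponentIn (fatouSet f) (f^[n] z)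

/-- A wandering domain: a Fatou component that is neither periodic nor preperiodic. -/
def IsWanderingDomain (f : ℂ → ℂ) (U : Set ℂ) : Prop :=
  IsFatouComponent f U ∧ ∀ m p : ℕ, 0 < p → fatouImage f U (m + p) ≠ fatouImage f U m

/-- The hyperbolic distance (of curvature `-1`) in the unit disc. -/
def discDist (a b : ℂ) : ℝ :=
  Real.log ((1 + ‖(a - b) / (1 - (starRingEnd ℂ) a * b)‖) /
    (1 - ‖(a - b) / (1 - (starRingEnd ℂ) a * b)‖))

/-- `π` restricts to a holomorphic covering map of the unit disc onto `U`. As the disc is simply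
connected, this is a universal covering. -/
def IsUniversalCovering (π : ℂ → ℂ) (U : Set ℂ) : Prop :=
  DifferentiableOn ℂ π (Metric.ball 0 1) ∧ SurjOn π (Metric.ball 0 1) U ∧
    ∃ h : MapsTo π (Metric.ball 0 1) U, IsCoveringMap (h.restrict π (Metric.ball 0 1) U)

/-- The hyperbolic distance in a hyperbolic domain `U ⊆ ℂ`: the quotient distance of the hyperbolic
distance of the unit disc under the universal covering. (Any two universal coverings of `U` by the
disc differ by a disc automorphism, so that each of them gives the same set of distances.) -/
def hypDist (U : Set ℂ) (z w : ℂ) : ℝ :=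
  sInf {d : ℝ | ∃ π : ℂ → ℂ, IsUniversalCovering π U ∧
    ∃ a ∈ Metric.ball (0 : ℂ) 1, ∃ b ∈ Metric.ball (0 : ℂ) 1,
      π a = z ∧ π b = w ∧ d = discDist a b}

/-- `l` is the hyperbolic distortion of `f : U → V` at `z`. -/
def HasHypDistortion (f : ℂ → ℂ) (U V : Set ℂ) (z : ℂ) (l : ℝ) : Prop :=
  Tendsto (fun z' => hypDist V (f z') (f z) / hypDist U z' z) (𝓝[≠] z) (𝓝 l)

/-- The hyperbolic distance in `U_n` between the `n`-th iterates of two points of `U`. -/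
def orbitDist (f : ℂ → ℂ) (U : Set ℂ) (n : ℕ) (z z' : ℂ) : ℝ :=
  hypDist (fatouImage f U n) (f^[n] z) (f^[n] z')

/-- The pairs of points of `U` whose orbits eventually coincide. -/
def coalescingPairs (f : ℂ → ℂ) (U : Set ℂ) : Set (ℂ × ℂ) :=
  {q | q ∈ U ×ˢ U ∧ ∃ k : ℕ, f^[k] q.1 = f^[k] q.2}

/-- `U` is (hyperbolically) contracting. -/
def IsContracting (f : ℂ → ℂ) (U : Set ℂ) : Prop :=
  ∀ z ∈ U, ∀ z' ∈ U, Tendsto (fun n => orbitDist f U n z z') atTop (𝓝 0)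

/-- `U` is (hyperbolically) semi-contracting. -/
def IsSemiContracting (f : ℂ → ℂ) (U : Set ℂ) : Prop :=
  ∀ z z' : ℂ, (z, z') ∈ (U ×ˢ U) \ coalescingPairs f U →
    ∃ c : ℝ, 0 < c ∧ Tendsto (fun n => orbitDist f U n z z') atTop (𝓝 c) ∧
      ∀ n, orbitDist f U n z z' ≠ c

/-- `U` is (hyperbolically) eventually isometric; `N` does not depend on the pair of points. -/
def IsEventuallyIsometric (f : ℂ → ℂ) (U : Set ℂ) : Prop :=
  ∃ N : ℕ, 0 < N ∧ ∀ n ≥ N, ∀ z z' : ℂ, (z, z') ∈ (U ×ˢ U) \ coalescingPairs f U →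
    ∃ c : ℝ, 0 < c ∧ Tendsto (fun m => orbitDist f U m z z') atTop (𝓝 c) ∧
      orbitDist f U n z z' = c

end

/-! Once every `U_n` is conformally a disc, the theorem is about disc self-maps fixing the origin.
Riemann maps of the `U_n` sending f^n(z) to 0 turn f : U_n → U_{n+1} into g_n with g_n(0) = 0 and
|g_n'(0)| = λ_n(z), and the orbit of x ∈ U into points with w_{n+1} = w_n h_n(w_n), where h_n(w) =
g_n(w)/w. By the Schwarz lemma h_n is a self-map of the disc or a unimodular constant, so
Schwarz–Pick for h_n compares 1 - |h_n(w_n)| with 1 - |h_n(0)| = 1 - λ_n up to a constant depending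
only on |w_0| (`dslope_estimates`). Hence |w_n| = |w_0| ∏ |h_k(w_k)| tends to 0 if Σ(1 - λ_n)
diverges, and stays away from 0 if the sum converges and the two orbits never meet.

Divergence at one z therefore makes U contracting, a property that does not mention z. If U is not
contracting, every non-coalescing pair has a positive limit: take one of its points as base point.
If such a limit is attained, equality in the Schwarz lemma gives λ_n = 1 from then on, the g_n are
rotations, and all distances are frozen. A Baire argument (`exists_forall_iterate_ne`) supplies a
non-coalescing pair, which makes the three cases exclusive.

Only U is assumed simply connected, so the property must be carried along the orbit
(`exists_isRiemannMap_fatouImage`). The Riemann mapping theorem needs only holomorphic square roots.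
Suppose U_n has them and U_{n+1} is not full: some bounded open O has its boundary in U_{n+1} but is
not contained in it. Then O contains a Julia point, and the maximum and minimum principles provide
an iterate that is large on the boundary of O and has a zero in O; its image of O swallows U_n,
which is thus bounded. So f : U_n → U_{n+1} is proper, and the image of a thin annulus near the unit
circle would have to lie in O and also leave its closure. Hence U_{n+1} is full, and Dixon's proof
of Cauchy's theorem gives primitives and square roots on it. -/

/-! ### Normal families: Montel and Hurwitz -/

section Montel

/-- Montel's theorem: a uniformly bounded sequence of holomorphic functions has a locally uniformly
convergent subsequence. -/
theorem exists_subseq_tendstoLocallyUniformlyOn {Ω : Set ℂ} (hΩ : IsOpen Ω) {F : ℕ → ℂ → ℂ} {M : ℝ}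
    (hF : ∀ n, DifferentiableOn ℂ (F n) Ω) (hM : ∀ n, ∀ z ∈ Ω, ‖F n z‖ ≤ M) :
    ∃ φ : ℕ → ℕ, StrictMono φ ∧
      ∃ g : ℂ → ℂ, TendstoLocallyUniformlyOn (fun k => F (φ k)) g atTop Ω := by
  have hex : ∀ x : Ω, ∃ δ > 0, Metric.ball (x : ℂ) δ ⊆ Ω := fun x =>
    Metric.isOpen_iff.1 hΩ x x.2
  choose δ hδ hball using hex
  -- Pointwise bounds and Schwarz-type Lipschitz bounds at each centre. They are closed conditions
  -- for pointwise convergence, so Tychonoff makes `P` compact, and they make it equicontinuous, as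
  -- Arzelà–Ascoli requires.
  let P : Set (Ω → ℂ) := {g | (∀ x, g x ∈ Metric.closedBall (0 : ℂ) M) ∧
    ∀ x y : Ω, dist (y : ℂ) x < δ x → dist (g y) (g x) ≤ 2 * M / δ x * dist (y : ℂ) x}
  have hPcl : IsClosed P := by
    simp only [P, ofPred_and, ofPred_forall]
    refine (isClosed_iInter fun x => ?_).inter (isClosed_iInter fun x => isClosed_iInter fun y =>
      isClosed_iInter fun _ => ?_)
    · exact Metric.isClosed_closedBall.preimage (continuous_apply x)
    · exact isClosed_le ((continuous_apply y).dist (continuous_apply x)) continuous_const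
  have hPcomp : IsCompact P :=
    (isCompact_univ_pi fun _ : Ω => isCompact_closedBall (0 : ℂ) M).of_isClosed_subset hPcl
      fun g hg x _ => hg.1 x
  have hPeq : Equicontinuous ((↑) : P → Ω → ℂ) := by
    intro x
    rw [Metric.equicontinuousAt_iff]
    intro ε hε
    have hlim : Tendsto (fun d : ℝ => 2 * M / δ x * d) (𝓝 0) (𝓝 0) := by
      have : Continuous fun d : ℝ => 2 * M / δ x * d := by fun_prop
      simpa using this.tendsto 0
    obtain ⟨η, hη, hηε⟩ := Metric.eventually_nhds_iff.1 (hlim.eventually (gt_mem_nhds hε))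
    refine ⟨min η (δ x), lt_min hη (hδ x), fun y hy g => ?_⟩
    have hyx : dist (y : ℂ) x < min η (δ x) := hy
    rw [dist_comm]
    refine (g.2.2 x y (hyx.trans_le (min_le_right _ _))).trans_lt (hηε ?_)
    rw [Real.dist_eq, sub_zero, abs_of_nonneg dist_nonneg]
    exact hyx.trans_le (min_le_left _ _)
  let S : Set C(Ω, ℂ) := {g | (g : Ω → ℂ) ∈ P}
  have hS1 : ContinuousMap.toFun '' S = P := by
    refine Subset.antisymm ?_ fun g hg => ⟨⟨g, ?_⟩, hg, rfl⟩
    · rintro _ ⟨g, hg, rfl⟩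
      exact hg
    · exact hPeq.continuous ⟨g, hg⟩
  have hScomp : IsCompact S := by
    refine ArzelaAscoli.isCompact_of_equicontinuous S (hS1 ▸ hPcomp) ?_
    exact hPeq.comp (fun g : S => (⟨g.1, g.2⟩ : P))
  let G : ℕ → C(Ω, ℂ) := fun n => ⟨fun x => F n x, (hF n).continuousOn.comp_continuous
    continuous_subtype_val fun x => x.2⟩
  have hGS : ∀ n, G n ∈ S := by
    refine fun n => ⟨fun x => by simpa [G] using hM n x x.2, fun x y hxy => ?_⟩
    refine Complex.dist_le_div_mul_dist_of_mapsTo_ball ((hF n).mono (hball x)) ?_ hxy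
    intro z hz
    rw [mem_closedBall_iff_norm]
    calc ‖F n z - F n x‖ ≤ ‖F n z‖ + ‖F n x‖ := norm_sub_le _ _
      _ ≤ 2 * M := by linarith [hM n z (hball x hz), hM n x x.2]
  have : LocallyCompactSpace Ω := hΩ.locallyCompactSpace
  obtain ⟨g, -, φ, hφ, hlim⟩ := hScomp.isSeqCompact hGS
  refine ⟨φ, hφ, Function.extend Subtype.val g 0, ?_⟩
  rw [tendstoLocallyUniformlyOn_iff_tendstoLocallyUniformly_comp_coe]
  rw [ContinuousMap.tendsto_iff_tendstoLocallyUniformly] at hlim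
  have he : (Function.extend Subtype.val (g : Ω → ℂ) 0) ∘ (Subtype.val : Ω → ℂ) = g :=
    Function.extend_comp Subtype.val_injective _ _
  rw [he]
  exact hlim

/-- Hurwitz' theorem: a nonconstant locally uniform limit of injective holomorphic functions on a
domain is injective. -/
theorem injOn_of_tendstoLocallyUniformlyOn {Ω : Set ℂ} (hΩ : IsOpen Ω) (hc : IsPreconnected Ω)
    {F : ℕ → ℂ → ℂ} {g : ℂ → ℂ} (hF : ∀ n, DifferentiableOn ℂ (F n) Ω)
    (hinj : ∀ n, InjOn (F n) Ω) (hlim : TendstoLocallyUniformlyOn F g atTop Ω)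
    {z₀ : ℂ} (hz₀ : z₀ ∈ Ω) (hg' : deriv g z₀ ≠ 0) : InjOn g Ω := by
  have hg : DifferentiableOn ℂ g Ω := hlim.differentiableOn (Eventually.of_forall hF) hΩ
  intro a ha b hb hab
  by_contra hne
  have hgan : AnalyticOnNhd ℂ g Ω := hg.analyticOnNhd hΩ
  have hnc : ∀ᶠ z in 𝓝[≠] b, g z ≠ g b := by
    rcases (hgan b hb).eventually_eq_or_eventually_ne analyticAt_const (g := fun _ => g b) with h | h
    · exfalso
      have := hgan.eqOn_of_preconnected_of_eventuallyEq analyticOnNhd_const hc hb h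
      apply hg'
      have h2 : g =ᶠ[𝓝 z₀] fun _ => g b := by
        filter_upwards [hΩ.mem_nhds hz₀] with z hz using this hz
      rw [h2.deriv_eq, deriv_const]
    · exact h
  obtain ⟨r₀, hr₀, hr₀'⟩ := Metric.mem_nhdsWithin_iff.1 hnc
  obtain ⟨r₁, hr₁, hr₁'⟩ := Metric.isOpen_iff.1 hΩ b hb
  set r := min (min (r₀ / 2) (r₁ / 2)) (dist a b / 2) with hr
  have hdab : 0 < dist a b := dist_pos.2 hne
  have hrpos : 0 < r := by positivity
  have hrr₀ : r < r₀ := by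
    have : r ≤ r₀ / 2 := (min_le_left _ _).trans (min_le_left _ _)
    linarith
  have hrr₁ : r < r₁ := by
    have : r ≤ r₁ / 2 := (min_le_left _ _).trans (min_le_right _ _)
    linarith
  have hrab : r < dist a b := by
    have : r ≤ dist a b / 2 := min_le_right _ _
    linarith
  have hcbΩ : Metric.closedBall b r ⊆ Ω := (Metric.closedBall_subset_ball hrr₁).trans hr₁'
  obtain ⟨ε, hε, hεg⟩ : ∃ ε > 0, ∀ z ∈ Metric.sphere b r, ε ≤ ‖g z - g b‖ := by
    have hne : (Metric.sphere b r).Nonempty := NormedSpace.sphere_nonempty.2 hrpos.le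
    have hcont : ContinuousOn (fun z => ‖g z - g b‖) (Metric.sphere b r) :=
      ((hg.continuousOn.mono (Metric.sphere_subset_closedBall.trans hcbΩ)).sub
        continuousOn_const).norm
    obtain ⟨x, hx, hmin⟩ := (isCompact_sphere b r).exists_isMinOn hne hcont
    refine ⟨‖g x - g b‖, ?_, fun z hz => hmin hz⟩
    refine norm_pos_iff.2 (sub_ne_zero.2 ?_)
    refine hr₀' ⟨?_, ?_⟩
    · rw [Metric.mem_ball, Metric.mem_sphere.1 hx]; exact hrr₀
    · rintro rfl
      simp at hx
      exact hrpos.ne hx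
  have hK := (tendstoLocallyUniformlyOn_iff_forall_isCompact hΩ).1 hlim
    (insert a (Metric.closedBall b r)) (insert_subset ha hcbΩ)
    ((isCompact_closedBall b r).insert a)
  -- With error ε/9, `F n` stays at least ε - 2ε/9 > ε/2 away from `F n b` on the sphere, so the
  -- image of the closed ball contains the ε/4-ball about `F n b`. As `g a = g b`, the value `F n a`
  -- is within 2ε/9 < ε/4 and is taken a second time.
  obtain ⟨n, hn⟩ := (Metric.tendstoUniformlyOn_iff.1 hK (ε / 9) (by positivity)).exists
  have hbK : b ∈ Metric.closedBall b r := Metric.mem_closedBall_self hrpos.le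
  have hna := hn a (mem_insert _ _)
  have hnb := hn b (mem_insert_of_mem _ hbK)
  have hsub := DiffContOnCl.ball_subset_image_closedBall (f := F n) (z₀ := b) (r := r) (ε := ε / 2)
    (((hF n).mono hcbΩ).diffContOnCl_ball subset_rfl) hrpos (fun z hz => by
      have h1 := hn z (mem_insert_of_mem _ (Metric.sphere_subset_closedBall hz))
      have h2 := hεg z hz
      rw [dist_eq_norm] at h1 hnb
      have h3 : ‖g z - g b‖ ≤ ‖g z - F n z‖ + ‖F n z - F n b‖ + ‖g b - F n b‖ := by
        have : g z - g b = (g z - F n z) + (F n z - F n b) - (g b - F n b) := by ring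
        rw [this]
        exact (norm_sub_le _ _).trans (add_le_add_left (norm_add_le _ _) _)
      linarith) (by
      refine Eventually.frequently (f := 𝓝[≠] b) ?_ |>.filter_mono nhdsWithin_le_nhds
      have hbb : Metric.closedBall b r ∈ 𝓝[≠] b :=
        mem_nhdsWithin_of_mem_nhds (Metric.closedBall_mem_nhds b hrpos)
      filter_upwards [self_mem_nhdsWithin, hbb] with z hz hz2 h
      exact hz (hinj n (hcbΩ hz2) hb h))
  have hmem : F n a ∈ Metric.ball (F n b) (ε / 2 / 2) := by
    rw [Metric.mem_ball]
    have := dist_triangle4 (F n a) (g a) (g b) (F n b)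
    rw [hab, dist_self] at this
    rw [dist_comm, hab] at hna
    linarith
  obtain ⟨c, hc1, hc2⟩ := hsub hmem
  have := hinj n (hcbΩ hc1) ha hc2
  rw [this, Metric.mem_closedBall] at hc1
  linarith

end Montel

/-! ### Disc automorphisms and Schwarz–Pick -/

section Moebius

/-- The disc automorphism that sends `a` to `0`. -/
noncomputable def mob (a z : ℂ) : ℂ := (z - a) / (1 - (starRingEnd ℂ) a * z)

theorem one_sub_conj_mul_ne_zero {a z : ℂ} (ha : ‖a‖ < 1) (hz : ‖z‖ ≤ 1) :
    1 - (starRingEnd ℂ) a * z ≠ 0 := by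
  intro h
  have h1 : ‖(starRingEnd ℂ) a * z‖ = 1 := by
    rw [← sub_eq_zero.1 h, norm_one]
  rw [norm_mul, RCLike.norm_conj] at h1
  nlinarith [norm_nonneg a, norm_nonneg z]

theorem norm_one_sub_conj_mul_sq_sub (a z : ℂ) :
    ‖1 - (starRingEnd ℂ) a * z‖ ^ 2 - ‖z - a‖ ^ 2 = (1 - ‖a‖ ^ 2) * (1 - ‖z‖ ^ 2) := by
  simp only [Complex.sq_norm, Complex.normSq_apply, Complex.sub_re, Complex.sub_im, Complex.mul_re,
    Complex.mul_im, Complex.conj_re, Complex.conj_im, Complex.one_re, Complex.one_im]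
  ring

theorem one_sub_norm_mob_sq {a z : ℂ} (ha : ‖a‖ < 1) (hz : ‖z‖ ≤ 1) :
    (1 - ‖mob a z‖ ^ 2) * ‖1 - (starRingEnd ℂ) a * z‖ ^ 2 = (1 - ‖a‖ ^ 2) * (1 - ‖z‖ ^ 2) := by
  have h : ‖1 - (starRingEnd ℂ) a * z‖ ≠ 0 := norm_ne_zero_iff.2 (one_sub_conj_mul_ne_zero ha hz)
  rw [← norm_one_sub_conj_mul_sq_sub, mob, norm_div, div_pow, sub_mul,
    div_mul_cancel₀ _ (pow_ne_zero 2 h), one_mul]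

theorem norm_mob_lt_one {a z : ℂ} (ha : ‖a‖ < 1) (hz : ‖z‖ < 1) : ‖mob a z‖ < 1 := by
  have h : 0 < ‖1 - (starRingEnd ℂ) a * z‖ := norm_pos_iff.2 (one_sub_conj_mul_ne_zero ha hz.le)
  rw [mob, norm_div, div_lt_one h]
  refine lt_of_pow_lt_pow_left₀ 2 h.le ?_
  have h1 : 0 < 1 - ‖a‖ ^ 2 := by nlinarith [norm_nonneg a]
  have h2 : 0 < 1 - ‖z‖ ^ 2 := by nlinarith [norm_nonneg z]
  nlinarith [norm_one_sub_conj_mul_sq_sub a z, mul_pos h1 h2]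

theorem mapsTo_mob {a : ℂ} (ha : ‖a‖ < 1) : MapsTo (mob a) (Metric.ball 0 1) (Metric.ball 0 1) :=
  fun z hz => by
    rw [mem_ball_zero_iff] at hz ⊢
    exact norm_mob_lt_one ha hz

theorem mob_self (a : ℂ) : mob a a = 0 := by simp [mob]

theorem mob_zero_right (a : ℂ) : mob a 0 = -a := by simp [mob]

theorem mob_neg_mob {a z : ℂ} (ha : ‖a‖ < 1) (hz : ‖z‖ < 1) : mob (-a) (mob a z) = z := by
  have h1 := one_sub_conj_mul_ne_zero ha hz.le
  have h3 := one_sub_conj_mul_ne_zero (a := -a) (by simpa using ha) (norm_mob_lt_one ha hz).le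
  have h4 : mob (-a) (mob a z) = (mob a z + a) / (1 - (starRingEnd ℂ) (-a) * mob a z) := by
    simp [mob]
  have hm : mob a z * (1 - (starRingEnd ℂ) a * z) = z - a := div_mul_cancel₀ _ h1
  rw [h4, div_eq_iff h3]
  refine mul_right_cancel₀ h1 ?_
  rw [map_neg]
  linear_combination (1 - z * (starRingEnd ℂ) a) * hm

theorem norm_mob_comm (a z : ℂ) : ‖mob a z‖ = ‖mob z a‖ := by
  rw [mob, mob, norm_div, norm_div, norm_sub_rev]
  congr 1
  rw [← RCLike.norm_conj]
  simp [mul_comm]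

theorem injOn_mob {a : ℂ} (ha : ‖a‖ < 1) : InjOn (mob a) (Metric.ball 0 1) := by
  intro z hz w hw h
  rw [mem_ball_zero_iff] at hz hw
  rw [← mob_neg_mob ha hz, h, mob_neg_mob ha hw]

theorem hasDerivAt_mob {a z : ℂ} (ha : ‖a‖ < 1) (hz : ‖z‖ < 1) :
    HasDerivAt (mob a) ((1 - (starRingEnd ℂ) a * a) / (1 - (starRingEnd ℂ) a * z) ^ 2) z := by
  have h1 := one_sub_conj_mul_ne_zero ha hz.le
  have h := ((hasDerivAt_id z).sub_const a).fun_div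
    (((hasDerivAt_id z).const_mul ((starRingEnd ℂ) a)).const_sub 1) h1
  refine h.congr_deriv ?_
  simp only [id]
  ring

theorem differentiableOn_mob {a : ℂ} (ha : ‖a‖ < 1) :
    DifferentiableOn ℂ (mob a) (Metric.ball 0 1) := fun _ hz =>
  (hasDerivAt_mob ha (mem_ball_zero_iff.1 hz)).differentiableAt.differentiableWithinAt

/-- The Schwarz–Pick lemma. -/
theorem norm_mob_le_of_mapsTo_ball {g : ℂ → ℂ} (hg : DifferentiableOn ℂ g (Metric.ball 0 1))
    (hm : MapsTo g (Metric.ball 0 1) (Metric.ball 0 1)) {a b : ℂ} (ha : ‖a‖ < 1) (hb : ‖b‖ < 1) :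
    ‖mob (g a) (g b)‖ ≤ ‖mob a b‖ := by
  have hga : ‖g a‖ < 1 := by simpa using hm (by simpa using ha : a ∈ Metric.ball (0 : ℂ) 1)
  have hna : ‖-a‖ < 1 := by simpa using ha
  have key := Complex.norm_le_norm_of_mapsTo_ball (f := mob (g a) ∘ g ∘ mob (-a)) (R := 1)
    (z := mob a b) ((differentiableOn_mob hga).comp (hg.comp (differentiableOn_mob hna)
      (mapsTo_mob hna)) (hm.comp (mapsTo_mob hna)))
    ((mapsTo_mob hga).comp (hm.comp (mapsTo_mob hna)) |>.mono_right Metric.ball_subset_closedBall)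
    (by simp [mob_zero_right, mob_self]) (norm_mob_lt_one ha hb)
  simpa [mob_neg_mob ha hb] using key

end Moebius

/-! ### The Riemann mapping theorem from square roots -/

section RiemannMapping

/-- Holomorphic functions without zeros on `Ω` have holomorphic square roots. -/
def HasHolomorphicSqrt (Ω : Set ℂ) : Prop :=
  ∀ g : ℂ → ℂ, DifferentiableOn ℂ g Ω → (∀ z ∈ Ω, g z ≠ 0) →
    ∃ s : ℂ → ℂ, DifferentiableOn ℂ s Ω ∧ ∀ z ∈ Ω, s z ^ 2 = g z

/-- `ψ` is a conformal map of `Ω` onto the unit disc with inverse `φ`. -/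
structure IsRiemannMap (Ω : Set ℂ) (ψ φ : ℂ → ℂ) : Prop where
  diff : DifferentiableOn ℂ ψ Ω
  diff_symm : DifferentiableOn ℂ φ (Metric.ball 0 1)
  mapsTo : MapsTo ψ Ω (Metric.ball 0 1)
  mapsTo_symm : MapsTo φ (Metric.ball 0 1) Ω
  left_inv : ∀ z ∈ Ω, φ (ψ z) = z
  right_inv : ∀ w ∈ Metric.ball (0 : ℂ) 1, ψ (φ w) = w

theorem not_eventually_const_of_injOn {Ω : Set ℂ} (hΩ : IsOpen Ω) {g : ℂ → ℂ} (hinj : InjOn g Ω)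
    {z : ℂ} (hz : z ∈ Ω) : ¬ ∀ᶠ w in 𝓝 z, g w = g z := by
  intro h
  have h2 : ∀ᶠ w in 𝓝[≠] z, w = z := by
    filter_upwards [mem_nhdsWithin_of_mem_nhds h, mem_nhdsWithin_of_mem_nhds (hΩ.mem_nhds hz)]
      with w hw hwΩ using hinj hwΩ hz hw
  obtain ⟨w, hw, hw'⟩ := (h2.and self_mem_nhdsWithin).exists
  exact hw' hw

theorem map_nhds_of_injOn {Ω : Set ℂ} (hΩ : IsOpen Ω) {g : ℂ → ℂ} (hg : DifferentiableOn ℂ g Ω)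
    (hinj : InjOn g Ω) {z : ℂ} (hz : z ∈ Ω) : 𝓝 (g z) ≤ map g (𝓝 z) :=
  ((hg.analyticOnNhd hΩ z hz).eventually_constant_or_nhds_le_map_nhds).resolve_left
    (not_eventually_const_of_injOn hΩ hinj hz)

/-- The inverse of an injective holomorphic map is holomorphic. -/
theorem differentiableAt_leftInverse_of_injOn {Ω : Set ℂ} (hΩ : IsOpen Ω) {g φ : ℂ → ℂ}
    (hg : DifferentiableOn ℂ g Ω) (hinj : InjOn g Ω) (hφ : ∀ z ∈ Ω, φ (g z) = z)
    {z : ℂ} (hz : z ∈ Ω) : DifferentiableAt ℂ φ (g z) := by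
  have hmem : ∀ z ∈ Ω, ∀ N ∈ 𝓝 z, g '' (N ∩ Ω) ∈ 𝓝 (g z) := fun z hz N hN =>
    map_nhds_of_injOn hΩ hg hinj hz (image_mem_map (inter_mem hN (hΩ.mem_nhds hz)))
  have hcont : ∀ z ∈ Ω, ContinuousAt φ (g z) := by
    intro z hz N hN
    rw [hφ z hz] at hN
    refine mem_map.2 (mem_of_superset (hmem z hz N hN) ?_)
    rintro _ ⟨w, ⟨hwN, hwΩ⟩, rfl⟩
    simpa [hφ w hwΩ] using hwN
  have hder : ∀ z ∈ Ω, deriv g z ≠ 0 → DifferentiableAt ℂ φ (g z) := by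
    intro z hz h
    have hd : HasDerivAt g (deriv g z) (φ (g z)) := by
      rw [hφ z hz]
      exact (hg.differentiableAt (hΩ.mem_nhds hz)).hasDerivAt
    refine (hd.of_local_left_inverse (hcont z hz) h ?_).differentiableAt
    refine mem_of_superset (hmem z hz univ univ_mem) ?_
    rintro _ ⟨w, ⟨-, hwΩ⟩, rfl⟩
    simp [hφ w hwΩ]
  -- No proof that `deriv g` is zero-free is needed: its zeros are isolated, so `φ` is holomorphic
  -- on a punctured neighbourhood and continuous at the centre, and the singularity is removable.
  refine (Complex.analyticAt_of_differentiable_on_punctured_nhds_of_continuousAt ?_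
    (hcont z hz)).differentiableAt
  have hne : ∀ᶠ w in 𝓝[≠] z, deriv g w ≠ 0 := by
    refine ((hg.analyticOnNhd hΩ z hz).deriv.eventually_eq_zero_or_eventually_ne_zero).resolve_left
      fun h => ?_
    obtain ⟨r, hr, hball⟩ := Metric.eventually_nhds_iff_ball.1 (h.and (hΩ.mem_nhds hz))
    refine not_eventually_const_of_injOn hΩ hinj hz ?_
    filter_upwards [Metric.ball_mem_nhds z hr] with w hw
    exact Metric.isOpen_ball.is_const_of_deriv_eq_zero (convex_ball z r).isPreconnected
      (hg.mono fun y hy => (hball y hy).2) (fun y hy => (hball y hy).1) hw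
      (Metric.mem_ball_self hr)
  rw [eventually_nhdsWithin_iff] at hne ⊢
  filter_upwards [hmem z hz _ hne]
  rintro _ ⟨w, ⟨hw, hwΩ⟩, rfl⟩ hwz
  exact hder w hwΩ (hw fun h => hwz (by rw [mem_singleton_iff.1 h]; rfl))

/-- A square root s of z - p is injective and never takes both v and -v. Its image contains a disc
about s(z₀), so it omits the opposite disc, and a multiple of 1/(s + s(z₀)) maps into the unit disc.
-/
theorem exists_injOn_mapsTo_ball {Ω : Set ℂ} (hΩ : IsOpen Ω) (hne : Ω ≠ univ)
    (hs : HasHolomorphicSqrt Ω) {z₀ : ℂ} (hz₀ : z₀ ∈ Ω) :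
    ∃ h : ℂ → ℂ, DifferentiableOn ℂ h Ω ∧ InjOn h Ω ∧ MapsTo h Ω (Metric.ball 0 1) ∧ h z₀ = 0 ∧
      deriv h z₀ ≠ 0 := by
  obtain ⟨p, hp⟩ := (ne_univ_iff_exists_notMem Ω).1 hne
  have hpz : ∀ z ∈ Ω, z - p ≠ 0 := fun z hz h => hp (by rwa [sub_eq_zero.1 h] at hz)
  obtain ⟨s, hsd, hs2⟩ := hs (fun z => z - p) (by fun_prop) hpz
  have hinj : InjOn s Ω := fun z hz w hw h => by
    have := hs2 z hz
    rw [h, hs2 w hw] at this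
    simpa using this.symm
  have hs0 : ∀ z ∈ Ω, s z ≠ 0 := fun z hz h => hpz z hz (by rw [← hs2 z hz, h]; simp)
  have hnh : s '' (univ ∩ Ω) ∈ 𝓝 (s z₀) :=
    map_nhds_of_injOn hΩ hsd hinj hz₀ (image_mem_map (inter_mem univ_mem (hΩ.mem_nhds hz₀)))
  obtain ⟨ε, hε, hball⟩ := Metric.mem_nhds_iff.1 hnh
  have hfar : ∀ z ∈ Ω, ε ≤ ‖s z + s z₀‖ := by
    intro z hz
    by_contra! hlt
    have hmem : -s z ∈ Metric.ball (s z₀) ε := by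
      rw [mem_ball_iff_norm, show -s z - s z₀ = -(s z + s z₀) by ring, norm_neg]
      exact hlt
    obtain ⟨w, ⟨-, hw⟩, hws⟩ := hball hmem
    have : w = z := by
      have h1 := hs2 w hw
      rw [hws, neg_sq, hs2 z hz] at h1
      simpa using h1.symm
    rw [this] at hws
    exact hs0 z hz (by linear_combination hws / 2)
  have hnz : ∀ z ∈ Ω, s z + s z₀ ≠ 0 := fun z hz h => by
    have := hfar z hz
    rw [h, norm_zero] at this
    linarith
  let h₁ : ℂ → ℂ := fun z => (ε / 2 : ℝ) / (s z + s z₀)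
  have hεc : ((ε / 2 : ℝ) : ℂ) ≠ 0 := by
    exact_mod_cast (half_pos hε).ne'
  have h₁d : DifferentiableOn ℂ h₁ Ω :=
    (differentiableOn_const _).div (hsd.add_const _) hnz
  have h₁m : MapsTo h₁ Ω (Metric.ball 0 1) := by
    intro z hz
    have := hfar z hz
    rw [mem_ball_zero_iff, norm_div, Complex.norm_real, Real.norm_of_nonneg (half_pos hε).le,
      div_lt_one (by linarith)]
    linarith
  have h₁inj : InjOn h₁ Ω := by
    intro z hz w hw hzw
    refine hinj hz hw ?_
    have h3 := hzw
    simp only [h₁] at h3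
    rw [div_eq_div_iff (hnz z hz) (hnz w hw)] at h3
    have := mul_left_cancel₀ hεc h3
    linear_combination -this
  have ha : ‖h₁ z₀‖ < 1 := by simpa using h₁m hz₀
  have hsz : HasDerivAt s (deriv s z₀) z₀ :=
    (hsd.differentiableAt (hΩ.mem_nhds hz₀)).hasDerivAt
  have hs' : deriv s z₀ ≠ 0 := by
    intro h0
    have h4 : HasDerivAt (fun z => z - p) (2 * s z₀ ^ 1 * deriv s z₀) z₀ := by
      refine (hsz.pow 2).congr_of_eventuallyEq ?_
      filter_upwards [hΩ.mem_nhds hz₀] with z hz using (hs2 z hz).symm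
    have h5 := h4.unique ((hasDerivAt_id z₀).sub_const p)
    rw [h0] at h5
    simp at h5
  have h₁' : HasDerivAt h₁ (-((ε / 2 : ℝ) * deriv s z₀) / (s z₀ + s z₀) ^ 2) z₀ := by
    refine ((hasDerivAt_const z₀ _).fun_div (hsz.add_const _) (hnz z₀ hz₀)).congr_deriv ?_
    ring
  have hden : 1 - (starRingEnd ℂ) (h₁ z₀) * h₁ z₀ ≠ 0 := one_sub_conj_mul_ne_zero ha ha.le
  refine ⟨mob (h₁ z₀) ∘ h₁, (differentiableOn_mob ha).comp h₁d h₁m, (injOn_mob ha).comp h₁inj h₁m,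
    (mapsTo_mob ha).comp h₁m, mob_self _, ?_⟩
  rw [((hasDerivAt_mob ha ha).comp z₀ h₁').deriv]
  refine mul_ne_zero (div_ne_zero hden (pow_ne_zero _ hden)) (div_ne_zero (neg_ne_zero.2
    (mul_ne_zero hεc hs')) (pow_ne_zero _ (hnz z₀ hz₀)))

/-- Koebe's square root transformation increases the derivative of a map that omits a value. -/
theorem exists_norm_deriv_lt_of_omits {Ω : Set ℂ} (hΩ : IsOpen Ω) (hs : HasHolomorphicSqrt Ω)
    {z₀ : ℂ} (hz₀ : z₀ ∈ Ω) {h : ℂ → ℂ} (hd : DifferentiableOn ℂ h Ω) (hinj : InjOn h Ω)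
    (hm : MapsTo h Ω (Metric.ball 0 1)) (h0 : h z₀ = 0) (hh' : deriv h z₀ ≠ 0) {α : ℂ}
    (hα : ‖α‖ < 1) (hom : ∀ z ∈ Ω, h z ≠ α) :
    ∃ k : ℂ → ℂ, DifferentiableOn ℂ k Ω ∧ InjOn k Ω ∧ MapsTo k Ω (Metric.ball 0 1) ∧ k z₀ = 0 ∧
      ‖deriv h z₀‖ < ‖deriv k z₀‖ := by
  have hn : ∀ z ∈ Ω, ‖h z‖ < 1 := fun z hz => by simpa using hm hz
  obtain ⟨s, hsd, hs2⟩ := hs (mob α ∘ h) ((differentiableOn_mob hα).comp hd hm) fun z hz h1 => by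
    have := mob_neg_mob hα (hn z hz)
    rw [show mob α (h z) = 0 from h1, mob_zero_right, neg_neg] at this
    exact hom z hz this.symm
  have hsm : MapsTo s Ω (Metric.ball 0 1) := by
    intro z hz
    have h1 : ‖s z‖ ^ 2 < 1 := by
      rw [← norm_pow, hs2 z hz]
      exact norm_mob_lt_one hα (hn z hz)
    rw [mem_ball_zero_iff]
    nlinarith [norm_nonneg (s z)]
  have hsinj : InjOn s Ω := fun z hz w hw h1 => by
    have h2 := hs2 z hz
    rw [h1, hs2 w hw] at h2
    exact hinj hz hw (injOn_mob hα (hm hz) (hm hw) h2.symm)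
  have hb : ‖s z₀‖ < 1 := by simpa using hsm hz₀
  have hα0 : α ≠ 0 := fun h1 => hom z₀ hz₀ (by rw [h0, h1])
  have hsα : s z₀ ^ 2 = -α := by
    rw [hs2 z₀ hz₀, Function.comp_apply, h0, mob_zero_right]
  have hnα : ‖s z₀‖ ^ 2 = ‖α‖ := by rw [← norm_pow, hsα, norm_neg]
  have hs0 : 0 < ‖s z₀‖ := by
    refine norm_pos_iff.2 fun h1 => hα0 ?_
    rw [h1] at hsα
    simpa using hsα.symm
  have hsz : HasDerivAt s (deriv s z₀) z₀ := (hsd.differentiableAt (hΩ.mem_nhds hz₀)).hasDerivAt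
  have hhz : HasDerivAt h (deriv h z₀) z₀ := (hd.differentiableAt (hΩ.mem_nhds hz₀)).hasDerivAt
  have h4 : HasDerivAt (mob α ∘ h) (2 * s z₀ ^ 1 * deriv s z₀) z₀ := by
    refine (hsz.pow 2).congr_of_eventuallyEq ?_
    filter_upwards [hΩ.mem_nhds hz₀] with z hz using (hs2 z hz).symm
  have h5 := h4.unique ((hasDerivAt_mob hα (hn z₀ hz₀)).comp z₀ hhz)
  rw [h0] at h5
  have hcm : ∀ w : ℂ, (starRingEnd ℂ) w * w = ((‖w‖ ^ 2 : ℝ) : ℂ) := fun w => by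
    rw [mul_comm, Complex.mul_conj, Complex.normSq_eq_norm_sq]
  have h6 : 2 * ‖s z₀‖ * ‖deriv s z₀‖ = (1 - ‖α‖ ^ 2) * ‖deriv h z₀‖ := by
    have := congrArg norm h5
    rw [hcm] at this
    simp only [mul_zero, sub_zero, one_pow, div_one, pow_one, norm_mul, Complex.norm_ofNat] at this
    rw [this]
    congr 1
    rw [← Complex.ofReal_one, ← Complex.ofReal_sub, Complex.norm_real, Real.norm_of_nonneg]
    nlinarith [norm_nonneg α]
  refine ⟨mob (s z₀) ∘ s, (differentiableOn_mob hb).comp hsd hsm, (injOn_mob hb).comp hsinj hsm,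
    (mapsTo_mob hb).comp hsm, mob_self _, ?_⟩
  rw [((hasDerivAt_mob hb hb).comp z₀ hsz).deriv, hcm, norm_mul]
  have h7 : ‖(1 - ((‖s z₀‖ ^ 2 : ℝ) : ℂ)) / (1 - ((‖s z₀‖ ^ 2 : ℝ) : ℂ)) ^ 2‖ =
      1 / (1 - ‖s z₀‖ ^ 2) := by
    rw [← Complex.ofReal_one, ← Complex.ofReal_sub, ← Complex.ofReal_pow, ← Complex.ofReal_div,
      Complex.norm_real]
    have hpos : 0 < 1 - ‖s z₀‖ ^ 2 := by nlinarith
    rw [Real.norm_of_nonneg (by positivity)]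
    field_simp
  rw [h7, one_div, inv_mul_eq_div, lt_div_iff₀ (by nlinarith)]
  have hx : 0 < ‖deriv h z₀‖ := norm_pos_iff.2 hh'
  rw [← hnα] at h6
  set t := ‖s z₀‖
  set x := ‖deriv h z₀‖
  set y := ‖deriv s z₀‖
  -- The derivative grows by the factor (1 + t²)/(2t), which exceeds 1 because (1 - t)² > 0.
  have h8 : 2 * t * (x * (1 - t ^ 2)) < 2 * t * y := by
    rw [h6]
    have : 0 < x * ((1 - t ^ 2) * (1 - t) ^ 2) := by
      have h9 : 0 < 1 - t := by linarith
      have h10 : 0 < 1 - t ^ 2 := by nlinarith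
      positivity
    nlinarith
  exact lt_of_mul_lt_mul_left h8 (by positivity)

/-- The Riemann mapping theorem. -/
theorem exists_isRiemannMap {Ω : Set ℂ} (hΩ : IsOpen Ω) (hc : IsPreconnected Ω) (hne : Ω ≠ univ)
    (hs : HasHolomorphicSqrt Ω) {z₀ : ℂ} (hz₀ : z₀ ∈ Ω) :
    ∃ ψ φ : ℂ → ℂ, IsRiemannMap Ω ψ φ ∧ ψ z₀ = 0 := by
  let Fam : Set (ℂ → ℂ) := {h | DifferentiableOn ℂ h Ω ∧ InjOn h Ω ∧
    MapsTo h Ω (Metric.ball 0 1) ∧ h z₀ = 0}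
  obtain ⟨h₀, h₀d, h₀i, h₀m, h₀z, h₀'⟩ := exists_injOn_mapsTo_ball hΩ hne hs hz₀
  let S : Set ℝ := (fun h => ‖deriv h z₀‖) '' Fam
  have hSne : S.Nonempty := ⟨_, h₀, ⟨h₀d, h₀i, h₀m, h₀z⟩, rfl⟩
  have hSb : BddAbove S := by
    obtain ⟨δ, hδ, hball⟩ := Metric.isOpen_iff.1 hΩ z₀ hz₀
    refine ⟨1 / δ, ?_⟩
    rintro _ ⟨h, ⟨hd, -, hm, hz⟩, rfl⟩
    refine Complex.norm_deriv_le_div_of_mapsTo_ball (hd.mono hball) ?_ hδ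
    rw [hz]
    exact (hm.mono_left hball).mono_right Metric.ball_subset_closedBall
  obtain ⟨u, -, hu, huS⟩ := exists_seq_tendsto_sSup hSne hSb
  choose H hH hHu using huS
  obtain ⟨σ, hσ, g, hg⟩ := exists_subseq_tendstoLocallyUniformlyOn (F := H) hΩ (fun n => (hH n).1)
    (M := 1) fun n z hz => (mem_ball_zero_iff.1 ((hH n).2.2.1 hz)).le
  have hgd : DifferentiableOn ℂ g Ω := hg.differentiableOn
    (Eventually.of_forall fun n => (hH (σ n)).1) hΩ
  have hder : ‖deriv g z₀‖ = sSup S := by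
    have h1 := (hg.deriv (Eventually.of_forall fun n => (hH (σ n)).1) hΩ).tendsto_at hz₀
    refine tendsto_nhds_unique h1.norm ?_
    have h2 := hu.comp hσ.tendsto_atTop
    refine h2.congr fun n => ?_
    simp [← hHu]
  have hderpos : deriv g z₀ ≠ 0 := by
    rw [← norm_pos_iff, hder]
    exact (norm_pos_iff.2 h₀').trans_le (le_csSup hSb ⟨h₀, ⟨h₀d, h₀i, h₀m, h₀z⟩, rfl⟩)
  have hginj : InjOn g Ω := injOn_of_tendstoLocallyUniformlyOn hΩ hc
    (fun n => (hH (σ n)).1) (fun n => (hH (σ n)).2.1) hg hz₀ hderpos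
  have hgle : ∀ z ∈ Ω, ‖g z‖ ≤ 1 := fun z hz =>
    le_of_tendsto (hg.tendsto_at hz).norm (Eventually.of_forall fun n =>
      (mem_ball_zero_iff.1 ((hH (σ n)).2.2.1 hz)).le)
  have hgm : MapsTo g Ω (Metric.ball 0 1) := by
    intro z hz
    rw [mem_ball_zero_iff]
    refine lt_of_le_of_ne (hgle z hz) fun h1 => ?_
    have hmax : IsMaxOn (norm ∘ g) Ω z := fun w hw => by
      simpa [h1] using hgle w hw
    -- A limit value on the unit circle would make `g` constant by the maximum principle, against
    -- injectivity.
    have hconst := Complex.eqOn_of_isPreconnected_of_isMaxOn_norm hc hΩ hgd hz hmax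
    refine not_eventually_const_of_injOn hΩ hginj hz ?_
    filter_upwards [hΩ.mem_nhds hz] with w hw using hconst hw
  have hg0 : g z₀ = 0 := by
    refine tendsto_nhds_unique (hg.tendsto_at hz₀) ?_
    simp only [(hH _).2.2.2]
    exact tendsto_const_nhds
  have hsurj : SurjOn g Ω (Metric.ball 0 1) := by
    intro α hα
    by_contra hnot
    obtain ⟨k, hkd, hki, hkm, hk0, hlt⟩ := exists_norm_deriv_lt_of_omits hΩ hs hz₀ hgd hginj hgm hg0
      hderpos (mem_ball_zero_iff.1 hα) fun z hz h1 => hnot ⟨z, hz, h1⟩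
    rw [hder] at hlt
    exact hlt.not_ge (le_csSup hSb ⟨k, ⟨hkd, hki, hkm, hk0⟩, rfl⟩)
  have hleft : ∀ z ∈ Ω, Function.invFunOn g Ω (g z) = z := fun z hz =>
    hginj.leftInvOn_invFunOn hz
  refine ⟨g, Function.invFunOn g Ω, ⟨hgd, ?_, hgm, hsurj.mapsTo_invFunOn, hleft,
    fun w hw => hsurj.rightInvOn_invFunOn hw⟩, hg0⟩
  intro w hw
  obtain ⟨z, hz, rfl⟩ := hsurj hw
  exact (differentiableAt_leftInverse_of_injOn hΩ hgd hginj hleft hz).differentiableWithinAt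

end RiemannMapping

/-! ### Cauchy's theorem on full domains (Dixon) -/

section Dixon

/-- The integral of `φ` along the segment from `a` to `b`. -/
noncomputable def segInt (φ : ℂ → ℂ) (a b : ℂ) : ℂ :=
  ∫ t in (0 : ℝ)..1, φ (a + t * (b - a)) * (b - a)

theorem add_mul_sub_mem_segment {a b : ℂ} {t : ℝ} (ht : t ∈ Icc (0 : ℝ) 1) :
    a + t * (b - a) ∈ segment ℝ a b := by
  rw [segment_eq_image']
  exact ⟨t, ht, by simp⟩

theorem continuousOn_comp_segment {φ : ℂ → ℂ} {a b : ℂ} (h : ContinuousOn φ (segment ℝ a b)) :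
    ContinuousOn (fun t : ℝ => φ (a + t * (b - a)) * (b - a)) (Icc 0 1) :=
  (h.comp (by fun_prop) fun _ ht => add_mul_sub_mem_segment ht).mul continuousOn_const

theorem intervalIntegrable_segment {φ : ℂ → ℂ} {a b : ℂ} (h : ContinuousOn φ (segment ℝ a b)) :
    IntervalIntegrable (fun t : ℝ => φ (a + t * (b - a)) * (b - a)) MeasureTheory.volume 0 1 := by
  refine ContinuousOn.intervalIntegrable ?_
  rw [uIcc_of_le zero_le_one]
  exact continuousOn_comp_segment h

theorem segInt_congr {φ₁ φ₂ : ℂ → ℂ} {a b : ℂ} (h : EqOn φ₁ φ₂ (segment ℝ a b)) :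
    segInt φ₁ a b = segInt φ₂ a b := by
  refine intervalIntegral.integral_congr fun t ht => ?_
  rw [uIcc_of_le zero_le_one] at ht
  simp only [h (add_mul_sub_mem_segment ht)]

theorem segInt_sub {φ₁ φ₂ : ℂ → ℂ} {a b : ℂ} (h₁ : ContinuousOn φ₁ (segment ℝ a b))
    (h₂ : ContinuousOn φ₂ (segment ℝ a b)) :
    segInt (fun ζ => φ₁ ζ - φ₂ ζ) a b = segInt φ₁ a b - segInt φ₂ a b := by
  rw [segInt, segInt, segInt, ← intervalIntegral.integral_sub (intervalIntegrable_segment h₁)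
    (intervalIntegrable_segment h₂)]
  simp only [sub_mul]

theorem segInt_const_mul (c : ℂ) (φ : ℂ → ℂ) (a b : ℂ) :
    segInt (fun ζ => c * φ ζ) a b = c * segInt φ a b := by
  rw [segInt, segInt, ← intervalIntegral.integral_const_mul]
  simp only [mul_assoc]

theorem segInt_eq_sub_of_hasDerivAt {φ G : ℂ → ℂ} {a b : ℂ} (hφ : ContinuousOn φ (segment ℝ a b))
    (hG : ∀ ζ ∈ segment ℝ a b, HasDerivAt G (φ ζ) ζ) : segInt φ a b = G b - G a := by
  have h := intervalIntegral.integral_eq_sub_of_hasDerivAt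
    (f := fun t : ℝ => G (a + t * (b - a))) (f' := fun t : ℝ => φ (a + t * (b - a)) * (b - a))
    (a := 0) (b := 1) (fun t ht => by
      rw [uIcc_of_le zero_le_one] at ht
      have h1 : HasDerivAt (fun t : ℝ => a + (t : ℂ) * (b - a)) (b - a) t := by
        simpa using ((Complex.ofRealCLM.hasDerivAt (x := t)).mul_const (b - a)).const_add a
      exact (hG _ (add_mul_sub_mem_segment ht)).comp t h1) (intervalIntegrable_segment hφ)
  rw [segInt, h]
  simp

theorem norm_segInt_le {φ : ℂ → ℂ} {a b : ℂ} {C : ℝ} (h : ∀ ζ ∈ segment ℝ a b, ‖φ ζ‖ ≤ C) :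
    ‖segInt φ a b‖ ≤ C * ‖b - a‖ := by
  have := intervalIntegral.norm_integral_le_of_norm_le_const (a := (0 : ℝ)) (b := 1)
    (f := fun t : ℝ => φ (a + t * (b - a)) * (b - a)) (C := C * ‖b - a‖) fun t ht => by
      rw [uIoc_of_le zero_le_one] at ht
      rw [norm_mul]
      exact mul_le_mul_of_nonneg_right (h _ (add_mul_sub_mem_segment (Ioc_subset_Icc_self ht)))
        (norm_nonneg _)
  simpa [segInt] using this

/-- Integrals of a kernel that is holomorphic in the parameter are holomorphic. -/
theorem differentiableOn_segInt {Φ : ℂ → ℂ → ℂ} {a b : ℂ} {V : Set ℂ} (hV : IsOpen V)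
    (hc : ContinuousOn (fun p : ℂ × ℂ => Φ p.1 p.2) (segment ℝ a b ×ˢ V))
    (hd : ∀ ζ ∈ segment ℝ a b, DifferentiableOn ℂ (Φ ζ) V) :
    DifferentiableOn ℂ (fun z => segInt (fun ζ => Φ ζ z) a b) V := by
  intro z₀ hz₀
  obtain ⟨ρ, hρ, hball⟩ := Metric.isOpen_iff.1 hV z₀ hz₀
  set r := ρ / 4 with hr
  have hrpos : 0 < r := by positivity
  have hcb : Metric.closedBall z₀ (2 * r) ⊆ V :=
    (Metric.closedBall_subset_ball (by rw [hr]; linarith)).trans hball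
  have hcomp : IsCompact (segment ℝ a b ×ˢ Metric.closedBall z₀ (2 * r)) := by
    refine IsCompact.prod ?_ (isCompact_closedBall _ _)
    rw [segment_eq_image']
    exact isCompact_Icc.image (by fun_prop)
  obtain ⟨M, hM⟩ := hcomp.exists_bound_of_continuousOn (hc.mono (prod_mono subset_rfl hcb))
  have hslice : ∀ z ∈ V, ContinuousOn (fun ζ => Φ ζ z) (segment ℝ a b) := fun z hz =>
    hc.comp (f := fun ζ => (ζ, z)) (by fun_prop) fun ζ hζ => ⟨hζ, hz⟩
  have hmeas : ∀ z ∈ V, MeasureTheory.AEStronglyMeasurable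
      (fun t : ℝ => Φ (a + t * (b - a)) z * (b - a))
      (MeasureTheory.volume.restrict (uIoc (0 : ℝ) 1)) := by
    intro z hz
    rw [uIoc_of_le zero_le_one]
    exact ((continuousOn_comp_segment (hslice z hz)).mono Ioc_subset_Icc_self).aestronglyMeasurable
      measurableSet_Ioc
  have hbV : Metric.ball z₀ r ⊆ V :=
    (Metric.ball_subset_closedBall.trans (Metric.closedBall_subset_closedBall (by linarith))).trans
      hcb
  have hder : ∀ t ∈ uIoc (0 : ℝ) 1, ∀ z ∈ V, HasDerivAt (fun z => Φ (a + t * (b - a)) z * (b - a))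
      (deriv (Φ (a + t * (b - a))) z * (b - a)) z := by
    intro t ht z hz
    rw [uIoc_of_le zero_le_one] at ht
    exact (((hd _ (add_mul_sub_mem_segment (Ioc_subset_Icc_self ht))).differentiableAt
      (hV.mem_nhds hz)).hasDerivAt).mul_const _
  -- Measurability in t of the parameter derivative: it is a pointwise limit of difference quotients
  -- along a sequence of increments.
  have hmeas' : MeasureTheory.AEStronglyMeasurable
      (fun t : ℝ => deriv (Φ (a + t * (b - a))) z₀ * (b - a))
      (MeasureTheory.volume.restrict (uIoc (0 : ℝ) 1)) := by
    obtain ⟨u, hu0, hu⟩ : ∃ u : ℕ → ℂ, (∀ n, z₀ + u n ∈ V) ∧ Tendsto u atTop (𝓝[≠] 0) := by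
      have h1 : ∀ᶠ w in 𝓝[≠] (0 : ℂ), z₀ + w ∈ V := by
        refine eventually_nhdsWithin_of_eventually_nhds ?_
        have : ContinuousAt (fun w : ℂ => z₀ + w) 0 := by fun_prop
        exact this.eventually (by simpa using hV.mem_nhds hz₀)
      obtain ⟨u, hu⟩ := exists_seq_tendsto (𝓝[≠] (0 : ℂ))
      obtain ⟨N, hN⟩ := eventually_atTop.1 (hu.eventually h1)
      exact ⟨fun n => u (n + N), fun n => hN _ (by omega), hu.comp (tendsto_add_atTop_nat N)⟩
    refine aestronglyMeasurable_of_tendsto_ae atTop (f := fun n (t : ℝ) =>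
      (u n)⁻¹ * (Φ (a + t * (b - a)) (z₀ + u n) * (b - a) - Φ (a + t * (b - a)) z₀ * (b - a)))
      (fun n => ((hmeas _ (hu0 n)).sub (hmeas z₀ hz₀)).const_mul _) ?_
    refine (MeasureTheory.ae_restrict_iff' measurableSet_uIoc).2 (Eventually.of_forall
      fun t ht => ?_)
    have := (hasDerivAt_iff_tendsto_slope_zero.1 (hder t ht z₀ hz₀)).comp hu
    simpa [Function.comp_def, smul_eq_mul] using this
  refine (intervalIntegral.hasDerivAt_integral_of_dominated_loc_of_deriv_le
    (F := fun z t => Φ (a + t * (b - a)) z * (b - a))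
    (F' := fun z t => deriv (Φ (a + t * (b - a))) z * (b - a))
    (bound := fun _ => M / r * ‖b - a‖) (Metric.ball_mem_nhds z₀ hrpos) ?_
    (intervalIntegrable_segment (hslice z₀ hz₀)) hmeas' ?_ (by simp) ?_).2.differentiableAt
    |>.differentiableWithinAt
  · filter_upwards [hV.mem_nhds hz₀] with z hz using hmeas z hz
  · refine Eventually.of_forall fun t ht z hz => ?_
    rw [uIoc_of_le zero_le_one] at ht
    rw [norm_mul]
    refine mul_le_mul_of_nonneg_right ?_ (norm_nonneg _)
    have hsub : Metric.closedBall z r ⊆ Metric.closedBall z₀ (2 * r) :=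
      Metric.closedBall_subset_closedBall' (by
        have := Metric.mem_ball.1 hz
        linarith)
    refine Complex.norm_deriv_le_of_forall_mem_sphere_norm_le hrpos
      (((hd _ (add_mul_sub_mem_segment (Ioc_subset_Icc_self ht))).mono
        (hsub.trans hcb)).diffContOnCl_ball subset_rfl) fun w hw => ?_
    exact hM (_, w) ⟨add_mul_sub_mem_segment (Ioc_subset_Icc_self ht),
      hsub (Metric.sphere_subset_closedBall hw)⟩
  · exact Eventually.of_forall fun t ht z hz => hder t ht z (hbV hz)

/-- The integral along a list of segments. -/
noncomputable def polyInt (φ : ℂ → ℂ) (l : List (ℂ × ℂ)) : ℂ :=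
  (l.map fun p => segInt φ p.1 p.2).sum

/-- The sum of the increments of `G` along a list of segments. -/
noncomputable def polyDiff (G : ℂ → ℂ) (l : List (ℂ × ℂ)) : ℂ :=
  (l.map fun p => G p.2 - G p.1).sum

/-- The union of a list of segments. -/
def polySupp (l : List (ℂ × ℂ)) : Set ℂ := ⋃ p ∈ {p | p ∈ l}, segment ℝ p.1 p.2

theorem segment_subset_polySupp {l : List (ℂ × ℂ)} {p : ℂ × ℂ} (hp : p ∈ l) :
    segment ℝ p.1 p.2 ⊆ polySupp l := subset_biUnion_of_mem (u := fun p : ℂ × ℂ => segment ℝ p.1 p.2)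
      (show p ∈ {p | p ∈ l} from hp)

theorem isCompact_polySupp (l : List (ℂ × ℂ)) : IsCompact (polySupp l) := by
  refine (List.finite_toSet l).isCompact_biUnion fun p _ => ?_
  rw [segment_eq_image']
  exact isCompact_Icc.image (by fun_prop)

theorem polyInt_congr {φ₁ φ₂ : ℂ → ℂ} {l : List (ℂ × ℂ)} (h : EqOn φ₁ φ₂ (polySupp l)) :
    polyInt φ₁ l = polyInt φ₂ l := by
  rw [polyInt, polyInt, List.map_congr_left]
  exact fun p hp => segInt_congr (h.mono (segment_subset_polySupp hp))

theorem sum_map_sub_complex {α : Type*} (l : List α) (u v : α → ℂ) :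
    (l.map fun p => u p - v p).sum = (l.map u).sum - (l.map v).sum := by
  induction l with
  | nil => simp
  | cons p l ih => simp only [List.map_cons, List.sum_cons, ih]; ring

theorem polyInt_sub {φ₁ φ₂ : ℂ → ℂ} {l : List (ℂ × ℂ)} (h₁ : ContinuousOn φ₁ (polySupp l))
    (h₂ : ContinuousOn φ₂ (polySupp l)) :
    polyInt (fun ζ => φ₁ ζ - φ₂ ζ) l = polyInt φ₁ l - polyInt φ₂ l := by
  rw [polyInt, polyInt, polyInt, ← sum_map_sub_complex, List.map_congr_left]
  exact fun p hp => segInt_sub (h₁.mono (segment_subset_polySupp hp))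
    (h₂.mono (segment_subset_polySupp hp))

theorem polyInt_const_mul (c : ℂ) (φ : ℂ → ℂ) (l : List (ℂ × ℂ)) :
    polyInt (fun ζ => c * φ ζ) l = c * polyInt φ l := by
  rw [polyInt, polyInt, ← List.sum_map_mul_left]
  simp only [segInt_const_mul]

theorem polyInt_eq_polyDiff {φ G : ℂ → ℂ} {l : List (ℂ × ℂ)} (hφ : ContinuousOn φ (polySupp l))
    (hG : ∀ ζ ∈ polySupp l, HasDerivAt G (φ ζ) ζ) : polyInt φ l = polyDiff G l := by
  rw [polyInt, polyDiff, List.map_congr_left]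
  exact fun p hp => segInt_eq_sub_of_hasDerivAt (hφ.mono (segment_subset_polySupp hp))
    fun ζ hζ => hG ζ (segment_subset_polySupp hp hζ)

theorem norm_polyInt_le {φ : ℂ → ℂ} {l : List (ℂ × ℂ)} {C : ℝ} (h : ∀ ζ ∈ polySupp l, ‖φ ζ‖ ≤ C) :
    ‖polyInt φ l‖ ≤ C * (l.map fun p => ‖p.2 - p.1‖).sum := by
  have key : ∀ l' : List (ℂ × ℂ), (∀ p ∈ l', p ∈ l) →
      ‖polyInt φ l'‖ ≤ C * (l'.map fun p => ‖p.2 - p.1‖).sum := by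
    intro l'
    induction l' with
    | nil => simp [polyInt]
    | cons p l' ih =>
      intro hl'
      have h1 := ih fun q hq => hl' q (List.mem_cons_of_mem _ hq)
      have h2 := norm_segInt_le fun ζ hζ =>
        h ζ (segment_subset_polySupp (hl' p List.mem_cons_self) hζ)
      simp only [polyInt, List.map_cons, List.sum_cons, mul_add] at h1 ⊢
      exact (norm_add_le _ _).trans (add_le_add h2 h1)
  exact key l fun _ => id

theorem differentiableOn_polyInt {Φ : ℂ → ℂ → ℂ} {l : List (ℂ × ℂ)} {V : Set ℂ} (hV : IsOpen V)
    (hc : ContinuousOn (fun p : ℂ × ℂ => Φ p.1 p.2) (polySupp l ×ˢ V))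
    (hd : ∀ ζ ∈ polySupp l, DifferentiableOn ℂ (Φ ζ) V) :
    DifferentiableOn ℂ (fun z => polyInt (fun ζ => Φ ζ z) l) V := by
  have key : ∀ l' : List (ℂ × ℂ), (∀ p ∈ l', p ∈ l) →
      DifferentiableOn ℂ (fun z => polyInt (fun ζ => Φ ζ z) l') V := by
    intro l'
    induction l' with
    | nil => intro _; simp [polyInt]
    | cons p l' ih =>
      intro h
      have hp := segment_subset_polySupp (h p List.mem_cons_self)
      have h1 := differentiableOn_segInt hV (hc.mono (prod_mono hp subset_rfl))
        fun ζ hζ => hd ζ (hp hζ)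
      have h2 := ih fun q hq => h q (List.mem_cons_of_mem _ hq)
      simp only [polyInt, List.map_cons, List.sum_cons] at h2 ⊢
      exact h1.add h2
  exact key l fun _ => id

/-- A closed polygon, i.e. an integral cycle, given as a list of segments. -/
def IsPolyCycle (l : List (ℂ × ℂ)) : Prop := ∀ G : ℂ → ℂ, polyDiff G l = 0

/-- `2πi` times the winding number. -/
noncomputable def polyWinding (l : List (ℂ × ℂ)) (z : ℂ) : ℂ := polyInt (fun ζ => 1 / (ζ - z)) l

theorem continuousOn_one_div_sub {s : Set ℂ} {z : ℂ} (hz : z ∉ s) :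
    ContinuousOn (fun ζ => 1 / (ζ - z)) s :=
  continuousOn_const.div (by fun_prop) fun ζ hζ h => hz (by rwa [sub_eq_zero.1 h] at hζ)

/-- The difference of the two integrands has the primitive log((ζ - z')/(ζ - z)) on the whole
support: the quotient is within distance 1 of 1, where the principal branch is holomorphic. -/
theorem polyWinding_eq_of_dist_lt {l : List (ℂ × ℂ)} (hl : IsPolyCycle l) {z z' : ℂ}
    (h : ∀ ζ ∈ polySupp l, ‖z' - z‖ < ‖ζ - z‖) : polyWinding l z' = polyWinding l z := by
  have hz : z ∉ polySupp l := fun h1 => by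
    have := h z h1
    rw [sub_self, norm_zero] at this
    exact this.not_ge (norm_nonneg _)
  have hz' : z' ∉ polySupp l := fun h1 => (h z' h1).false
  rw [← sub_eq_zero, polyWinding, polyWinding, ← polyInt_sub (continuousOn_one_div_sub hz')
    (continuousOn_one_div_sub hz), polyInt_eq_polyDiff
    (φ := fun ζ => 1 / (ζ - z') - 1 / (ζ - z)) (G := fun ζ => Complex.log ((ζ - z') / (ζ - z)))
    ((continuousOn_one_div_sub hz').sub (continuousOn_one_div_sub hz)), hl]
  intro ζ hζ
  have h1 : ζ - z ≠ 0 := fun h1 => hz (by rwa [sub_eq_zero.1 h1] at hζ)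
  have h2 : ζ - z' ≠ 0 := fun h1 => hz' (by rwa [sub_eq_zero.1 h1] at hζ)
  have hslit : (ζ - z') / (ζ - z) ∈ Complex.slitPlane := by
    rw [show (ζ - z') / (ζ - z) = 1 + -((z' - z) / (ζ - z)) by field_simp; ring]
    refine Complex.mem_slitPlane_of_norm_lt_one ?_
    rw [norm_neg, norm_div, div_lt_one (norm_pos_iff.2 h1)]
    exact h ζ hζ
  refine ((((hasDerivAt_id ζ).sub_const z').fun_div ((hasDerivAt_id ζ).sub_const z) h1).clog
    hslit).congr_deriv ?_
  simp only [id]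
  field_simp

theorem polyWinding_eq_zero_of_norm_lt {l : List (ℂ × ℂ)} (hl : IsPolyCycle l) {z : ℂ}
    (h : ∀ ζ ∈ polySupp l, ‖ζ‖ < ‖z‖) : polyWinding l z = 0 := by
  have hz : z ∉ polySupp l := fun h1 => (h z h1).false
  rw [polyWinding, polyInt_eq_polyDiff (G := fun ζ => Complex.log (1 - ζ / z))
    (continuousOn_one_div_sub hz), hl]
  intro ζ hζ
  have hz0 : z ≠ 0 := norm_pos_iff.1 ((norm_nonneg _).trans_lt (h ζ hζ))
  have h1 : ζ - z ≠ 0 := fun h1 => hz (by rwa [sub_eq_zero.1 h1] at hζ)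
  have h2 : z - ζ ≠ 0 := fun h1 => hz (by rwa [← sub_eq_zero.1 h1] at hζ)
  have hslit : 1 - ζ / z ∈ Complex.slitPlane := by
    rw [sub_eq_add_neg]
    refine Complex.mem_slitPlane_of_norm_lt_one ?_
    rw [norm_neg, norm_div, div_lt_one (norm_pos_iff.2 hz0)]
    exact h ζ hζ
  refine ((((hasDerivAt_id ζ).div_const z).const_sub 1).clog hslit).congr_deriv ?_
  simp only [id]
  have h3 : 1 - ζ / z = (z - ζ) / z := by field_simp
  rw [h3]
  field_simp
  ring

/-- Every bounded open set whose boundary lies in `Ω` is contained in `Ω`: the complement of `Ω` has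
no compact pieces. -/
def IsFull (Ω : Set ℂ) : Prop :=
  ∀ O : Set ℂ, IsOpen O → Bornology.IsBounded O → frontier O ⊆ Ω → O ⊆ Ω

/-- The winding number is locally constant off the support, so any condition on its value is open.
-/
theorem isOpen_polyWinding_eq {l : List (ℂ × ℂ)} (hl : IsPolyCycle l) (P : ℂ → Prop) :
    IsOpen {z | z ∉ polySupp l ∧ P (polyWinding l z)} := by
  rw [Metric.isOpen_iff]
  rintro z ⟨hz, hP⟩
  obtain ⟨δ, hδ, hball⟩ := Metric.isOpen_iff.1 (isCompact_polySupp l).isClosed.isOpen_compl z hz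
  refine ⟨δ, hδ, fun z' hz' => ⟨hball hz', ?_⟩⟩
  rw [polyWinding_eq_of_dist_lt hl (z := z)]
  · exact hP
  · intro ζ hζ
    refine (mem_ball_iff_norm.1 hz').trans_le ?_
    by_contra! hlt
    exact hball (mem_ball_iff_norm.2 hlt) hζ

/-- The points of nonzero winding number form a bounded open set whose boundary lies on the cycle;
fullness applies to this set. -/
theorem mem_of_polyWinding_ne_zero {Ω : Set ℂ} (hfull : IsFull Ω) {l : List (ℂ × ℂ)}
    (hl : IsPolyCycle l) (hlΩ : polySupp l ⊆ Ω) {z : ℂ} (hz : z ∉ polySupp l)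
    (hw : polyWinding l z ≠ 0) : z ∈ Ω := by
  have hO := isOpen_polyWinding_eq hl (fun w => w ≠ 0)
  refine hfull {z | z ∉ polySupp l ∧ polyWinding l z ≠ 0} hO ?_ ?_ ⟨hz, hw⟩
  · obtain ⟨R, hR⟩ := (isCompact_polySupp l).isBounded.exists_norm_le
    refine (Metric.isBounded_closedBall (x := (0 : ℂ)) (r := R)).subset ?_
    rintro w ⟨-, hw⟩
    rw [mem_closedBall_zero_iff]
    by_contra! hlt
    exact hw (polyWinding_eq_zero_of_norm_lt hl fun ζ hζ => (hR ζ hζ).trans_lt hlt)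
  · intro w hwf
    by_contra hwΩ
    have hws : w ∉ polySupp l := fun h => hwΩ (hlΩ h)
    have hwO : ¬ (w ∉ polySupp l ∧ polyWinding l w ≠ 0) := fun h => by
      rw [hO.frontier_eq] at hwf
      exact hwf.2 h
    have hw0 : polyWinding l w = 0 := by
      by_contra h
      exact hwO ⟨hws, h⟩
    have hcl := mem_closure_iff.1 (frontier_subset_closure hwf) _
      (isOpen_polyWinding_eq hl (fun w => w = 0)) ⟨hws, hw0⟩
    obtain ⟨v, hv1, hv2⟩ := hcl
    exact hv2.2 hv1.2

theorem dslope_eq_div {g : ℂ → ℂ} {ζ z : ℂ} (h : z ≠ ζ) :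
    dslope g ζ z = (g z - g ζ) / (z - ζ) := by
  rw [dslope_of_ne _ h, slope_def_field]

theorem continuousOn_dslope_prod {Ω : Set ℂ} (hΩ : IsOpen Ω) {g : ℂ → ℂ}
    (hg : DifferentiableOn ℂ g Ω) :
    ContinuousOn (fun p : ℂ × ℂ => dslope g p.1 p.2) (Ω ×ˢ Ω) := by
  rintro ⟨ζ, z⟩ ⟨hζ, hz⟩
  simp only at hζ hz
  refine ContinuousAt.continuousWithinAt ?_
  have hgc : ∀ w ∈ Ω, ContinuousAt g w := fun w hw =>
    (hg.differentiableAt (hΩ.mem_nhds hw)).continuousAt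
  by_cases hne : z = ζ
  · subst hne
    have hdc : ContinuousAt (deriv g) z :=
      ((hg.analyticOnNhd hΩ z hz).deriv).continuousAt
    rw [Metric.continuousAt_iff]
    intro ε hε
    obtain ⟨δ₁, hδ₁, h₁⟩ := Metric.continuousAt_iff.1 hdc (ε / 2) (half_pos hε)
    obtain ⟨δ₂, hδ₂, h₂⟩ := Metric.isOpen_iff.1 hΩ z hz
    refine ⟨min δ₁ δ₂, lt_min hδ₁ hδ₂, ?_⟩
    rintro ⟨a, b⟩ hab
    rw [Prod.dist_eq, max_lt_iff] at hab
    simp only at hab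
    rw [dslope_same]
    refine lt_of_le_of_lt ?_ (half_lt_self hε)
    by_cases hba : b = a
    · subst hba
      rw [dslope_same]
      exact (h₁ (hab.1.trans_le (min_le_left _ _))).le
    -- Near the diagonal, apply the mean value inequality to g(w) - g'(z)w, whose derivative is
    -- small.
    · have hd : ∀ w ∈ Metric.ball z (min δ₁ δ₂), HasDerivWithinAt (fun w => g w - deriv g z * w)
          (deriv g w - deriv g z) (Metric.ball z (min δ₁ δ₂)) w := by
        intro w hw
        have hwΩ : w ∈ Ω := h₂ (Metric.ball_subset_ball (min_le_right _ _) hw)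
        refine HasDerivAt.hasDerivWithinAt ?_
        simpa using (hg.differentiableAt (hΩ.mem_nhds hwΩ)).hasDerivAt.fun_sub
          ((hasDerivAt_id w).const_mul (deriv g z))
      have hb := (convex_ball z (min δ₁ δ₂)).norm_image_sub_le_of_norm_hasDerivWithin_le hd
        (C := ε / 2) (fun w hw => by
          rw [← dist_eq_norm]
          exact (h₁ ((Metric.mem_ball.1 hw).trans_le (min_le_left _ _))).le)
        (Metric.mem_ball.2 hab.1) (Metric.mem_ball.2 hab.2)
      have hba' : b - a ≠ 0 := sub_ne_zero.2 hba
      rw [dslope_eq_div hba, dist_eq_norm, show (g b - g a) / (b - a) - deriv g z =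
        (g b - deriv g z * b - (g a - deriv g z * a)) / (b - a) by field_simp; ring, norm_div,
        div_le_iff₀ (norm_pos_iff.2 hba')]
      exact hb
  · have heq : (fun p : ℂ × ℂ => dslope g p.1 p.2) =ᶠ[𝓝 (ζ, z)]
        fun p => (g p.2 - g p.1) / (p.2 - p.1) := by
      have : ∀ᶠ p : ℂ × ℂ in 𝓝 (ζ, z), p.2 - p.1 ≠ 0 := by
        have hc : ContinuousAt (fun p : ℂ × ℂ => p.2 - p.1) (ζ, z) := by fun_prop
        exact hc.eventually_ne (sub_ne_zero.2 hne)
      filter_upwards [this] with p hp using dslope_eq_div (sub_ne_zero.1 hp)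
    refine ContinuousAt.congr ?_ heq.symm
    refine ContinuousAt.div ?_ (by fun_prop) (sub_ne_zero.2 hne)
    exact (ContinuousAt.comp (f := Prod.snd) (x := (ζ, z)) (hgc z hz) continuousAt_snd).sub
      (ContinuousAt.comp (f := Prod.fst) (x := (ζ, z)) (hgc ζ hζ) continuousAt_fst)

/-- Cauchy's theorem for full open sets, by Dixon's argument. -/
theorem polyInt_eq_zero_of_isFull {Ω : Set ℂ} (hΩ : IsOpen Ω) (hfull : IsFull Ω) {g : ℂ → ℂ}
    (hg : DifferentiableOn ℂ g Ω) {l : List (ℂ × ℂ)} (hl : IsPolyCycle l)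
    (hlΩ : polySupp l ⊆ Ω) {z₀ : ℂ} (hz₀ : z₀ ∈ Ω) : polyInt g l = 0 := by
  classical
  -- `G` vanishes at `z₀`, so `dslope G ζ z₀ = g ζ` and the integral of `g` becomes the value at
  -- `z₀` of the function `H` below.
  let G : ℂ → ℂ := fun ζ => g ζ * (ζ - z₀)
  have hG : DifferentiableOn ℂ G Ω := hg.mul (by fun_prop)
  have hGc : ContinuousOn G (polySupp l) := hG.continuousOn.mono hlΩ
  -- The two formulas agree where the winding number vanishes, and by fullness Ω and that region
  -- cover the plane. Thus `H` is entire and tends to 0 at infinity, so it is zero by Liouville.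
  let H : ℂ → ℂ := fun z => if z ∈ Ω then polyInt (fun ζ => dslope G ζ z) l
    else polyInt (fun ζ => G ζ / (ζ - z)) l
  let V : Set ℂ := {z | z ∉ polySupp l ∧ polyWinding l z = 0}
  have hV : IsOpen V := isOpen_polyWinding_eq hl (fun w => w = 0)
  have hcover : ∀ z, z ∈ Ω ∨ z ∈ V := fun z => by
    by_cases hz : z ∈ Ω
    · exact Or.inl hz
    · have h1 : z ∉ polySupp l := fun h => hz (hlΩ h)
      refine Or.inr ⟨h1, ?_⟩
      by_contra h2
      exact hz (mem_of_polyWinding_ne_zero hfull hl hlΩ h1 h2)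
  have hHV : ∀ z ∈ V, H z = polyInt (fun ζ => G ζ / (ζ - z)) l := by
    rintro z ⟨hz, hw⟩
    by_cases hzΩ : z ∈ Ω
    · have h1 : EqOn (fun ζ => dslope G ζ z) (fun ζ => G ζ / (ζ - z) - G z * (1 / (ζ - z)))
          (polySupp l) := by
        intro ζ hζ
        have hne : z ≠ ζ := fun h => hz (h ▸ hζ)
        have h2 : ζ - z ≠ 0 := sub_ne_zero.2 hne.symm
        have h3 : z - ζ ≠ 0 := sub_ne_zero.2 hne
        simp only [dslope_eq_div hne]
        field_simp
        ring
      have h4 : ContinuousOn (fun ζ => G ζ / (ζ - z)) (polySupp l) :=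
        hGc.div (by fun_prop) fun ζ hζ h => hz (by rwa [sub_eq_zero.1 h] at hζ)
      simp only [H, if_pos hzΩ]
      rw [polyInt_congr h1, polyInt_sub (φ₂ := fun ζ => G z * (1 / (ζ - z))) h4
        (continuousOn_const.mul (continuousOn_one_div_sub hz)),
        polyInt_const_mul]
      change _ - G z * polyWinding l z = _
      rw [hw, mul_zero, sub_zero]
    · simp only [H, if_neg hzΩ]
  have hHd : Differentiable ℂ H := by
    intro z
    rcases hcover z with hz | hz
    · have h1 := differentiableOn_polyInt (l := l) (Φ := fun ζ z => dslope G ζ z) hΩ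
        ((continuousOn_dslope_prod hΩ hG).mono (prod_mono hlΩ subset_rfl))
        fun ζ hζ => (Complex.differentiableOn_dslope (hΩ.mem_nhds (hlΩ hζ))).2 hG
      refine ((h1.differentiableAt (hΩ.mem_nhds hz))).congr_of_eventuallyEq ?_
      filter_upwards [hΩ.mem_nhds hz] with w hw using if_pos hw
    · have hsub : ∀ p ∈ polySupp l ×ˢ V, p.1 - p.2 ≠ 0 := fun p hp h =>
        hp.2.1 (by rw [← sub_eq_zero.1 h]; exact hp.1)
      have h1 := differentiableOn_polyInt (l := l) (Φ := fun ζ z => G ζ / (ζ - z)) hV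
        ((hGc.comp (by fun_prop) fun p hp => hp.1).div (by fun_prop) hsub)
        fun ζ hζ => (differentiableOn_const _).div (by fun_prop) fun z hz => hsub (ζ, z) ⟨hζ, hz⟩
      refine ((h1.differentiableAt (hV.mem_nhds hz))).congr_of_eventuallyEq ?_
      filter_upwards [hV.mem_nhds hz] with w hw using hHV w hw
  have hlim : Tendsto H (cocompact ℂ) (𝓝 0) := by
    obtain ⟨R, hR⟩ := (isCompact_polySupp l).isBounded.exists_norm_le
    obtain ⟨M, hM⟩ := (isCompact_polySupp l).exists_bound_of_continuousOn hGc
    set A := (l.map fun p => ‖p.2 - p.1‖).sum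
    have htop := tendsto_norm_cocompact_atTop (E := ℂ)
    refine squeeze_zero_norm' (a := fun z => |M| / (‖z‖ - R) * A) ?_ ?_
    · filter_upwards [htop.eventually_gt_atTop R] with z hz
      have hzV : z ∈ V := ⟨fun h => (hR z h).not_gt hz,
        polyWinding_eq_zero_of_norm_lt hl fun ζ hζ => (hR ζ hζ).trans_lt hz⟩
      rw [hHV z hzV]
      refine norm_polyInt_le fun ζ hζ => ?_
      rw [norm_div]
      refine div_le_div₀ (abs_nonneg _) ((hM ζ hζ).trans (le_abs_self _)) (sub_pos.2 hz) ?_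
      have h1 := norm_sub_norm_le z ζ
      rw [norm_sub_rev] at h1
      linarith [hR ζ hζ]
    · have h1 : Tendsto (fun z : ℂ => ‖z‖ - R) (cocompact ℂ) atTop :=
        tendsto_atTop_add_const_right _ (-R) htop
      simpa using (h1.const_div_atTop |M|).mul_const A
  have h0 := hHd.apply_eq_of_tendsto_cocompact z₀ hlim
  simp only [H, if_pos hz₀] at h0
  rw [← h0]
  refine polyInt_congr fun ζ hζ => ?_
  by_cases hne : z₀ = ζ
  · subst hne
    rw [dslope_same]
    have hgz := (hg.differentiableAt (hΩ.mem_nhds hz₀)).hasDerivAt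
    have := (hgz.fun_mul ((hasDerivAt_id z₀).sub_const z₀)).deriv
    simpa [G] using this.symm
  · have h2 : z₀ - ζ ≠ 0 := sub_ne_zero.2 hne
    rw [dslope_eq_div hne]
    simp only [G, sub_self, mul_zero, zero_sub]
    field_simp
    ring

/-- A list of segments in `Ω` whose boundary, as a chain, is `w - z`. -/
def IsPolyChain (Ω : Set ℂ) (z w : ℂ) (l : List (ℂ × ℂ)) : Prop :=
  polySupp l ⊆ Ω ∧ ∀ G : ℂ → ℂ, polyDiff G l = G w - G z

theorem polySupp_append (l₁ l₂ : List (ℂ × ℂ)) :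
    polySupp (l₁ ++ l₂) = polySupp l₁ ∪ polySupp l₂ := by
  ext z
  simp only [polySupp, mem_iUnion, mem_union, mem_ofPred_eq, List.mem_append]
  grind

theorem IsPolyChain.append {Ω : Set ℂ} {z w v : ℂ} {l₁ l₂ : List (ℂ × ℂ)}
    (h₁ : IsPolyChain Ω z w l₁) (h₂ : IsPolyChain Ω w v l₂) : IsPolyChain Ω z v (l₁ ++ l₂) := by
  refine ⟨?_, fun G => ?_⟩
  · rw [polySupp_append]
    exact union_subset h₁.1 h₂.1
  · have := h₁.2 G
    have := h₂.2 G
    simp only [polyDiff, List.map_append, List.sum_append] at *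
    grind

theorem isPolyChain_segment {Ω : Set ℂ} {z w : ℂ} (h : segment ℝ z w ⊆ Ω) :
    IsPolyChain Ω z w [(z, w)] := by
  refine ⟨?_, fun G => by simp [polyDiff]⟩
  simpa [polySupp] using h

theorem segInt_symm (φ : ℂ → ℂ) (a b : ℂ) : segInt φ b a = -segInt φ a b := by
  have h := intervalIntegral.integral_comp_sub_left (a := 0) (b := 1)
    (fun t : ℝ => φ (a + t * (b - a)) * (b - a)) 1
  rw [sub_self, sub_zero] at h
  rw [segInt, segInt, ← h, ← intervalIntegral.integral_neg]
  refine intervalIntegral.integral_congr fun t _ => ?_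
  have : a + (1 - t : ℝ) * (b - a) = b + t * (a - b) := by push_cast; ring
  simp only [this]
  ring

theorem polyInt_append (φ : ℂ → ℂ) (l₁ l₂ : List (ℂ × ℂ)) :
    polyInt φ (l₁ ++ l₂) = polyInt φ l₁ + polyInt φ l₂ := by
  simp [polyInt]

theorem polyInt_map_swap (φ : ℂ → ℂ) (l : List (ℂ × ℂ)) :
    polyInt φ (l.map Prod.swap) = -polyInt φ l := by
  induction l with
  | nil => simp [polyInt]
  | cons p l ih =>
    simp only [polyInt, List.map_cons, List.sum_cons] at ih ⊢
    rw [ih, Prod.fst_swap, Prod.snd_swap, segInt_symm]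
    ring

theorem IsPolyChain.swap {Ω : Set ℂ} {z w : ℂ} {l : List (ℂ × ℂ)} (h : IsPolyChain Ω z w l) :
    IsPolyChain Ω w z (l.map Prod.swap) := by
  refine ⟨fun ζ hζ => ?_, fun G => ?_⟩
  · simp only [polySupp, mem_iUnion, mem_ofPred_eq, List.mem_map] at hζ
    obtain ⟨_, ⟨p, hp, rfl⟩, hζ⟩ := hζ
    rw [Prod.fst_swap, Prod.snd_swap, segment_symm] at hζ
    exact h.1 (segment_subset_polySupp hp hζ)
  · rw [← neg_sub, ← h.2 G]
    clear h
    induction l with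
    | nil => simp [polyDiff]
    | cons p l ih =>
      simp only [polyDiff, List.map_cons, List.sum_cons] at ih ⊢
      rw [ih, Prod.fst_swap, Prod.snd_swap]
      ring

theorem exists_isPolyChain {Ω : Set ℂ} (hΩ : IsOpen Ω) (hc : IsPreconnected Ω) {z w : ℂ}
    (hz : z ∈ Ω) (hw : w ∈ Ω) : ∃ l, IsPolyChain Ω z w l := by
  refine hc.induction₂ (fun z w => ∃ l, IsPolyChain Ω z w l) (fun x hx => ?_) ?_ ?_ hz hw
  · obtain ⟨r, hr, hball⟩ := Metric.isOpen_iff.1 hΩ x hx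
    filter_upwards [mem_nhdsWithin_of_mem_nhds (Metric.ball_mem_nhds x hr)] with y hy
    exact ⟨_, isPolyChain_segment (((convex_ball x r).segment_subset
      (Metric.mem_ball_self hr) hy).trans hball)⟩
  · rintro x y v - - - ⟨l₁, h₁⟩ ⟨l₂, h₂⟩
    exact ⟨_, h₁.append h₂⟩
  · rintro x y - - ⟨l, h⟩
    exact ⟨_, h.swap⟩

/-- Holomorphic functions on full domains have primitives. -/
theorem exists_primitive_of_isFull {Ω : Set ℂ} (hΩ : IsOpen Ω) (hc : IsPreconnected Ω)
    (hfull : IsFull Ω) {g : ℂ → ℂ} (hg : DifferentiableOn ℂ g Ω) :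
    ∃ F : ℂ → ℂ, ∀ z ∈ Ω, HasDerivAt F (g z) z := by
  rcases Ω.eq_empty_or_nonempty with rfl | ⟨z₀, hz₀⟩
  · exact ⟨0, fun z hz => hz.elim⟩
  have hex : ∀ z : ℂ, ∃ l, z ∈ Ω → IsPolyChain Ω z₀ z l := fun z => by
    by_cases hz : z ∈ Ω
    · obtain ⟨l, hl⟩ := exists_isPolyChain hΩ hc hz₀ hz
      exact ⟨l, fun _ => hl⟩
    · exact ⟨[], fun h => (hz h).elim⟩
  choose L hL using hex
  refine ⟨fun z => polyInt g (L z), fun c hcΩ => ?_⟩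
  obtain ⟨r, hr, hball⟩ := Metric.isOpen_iff.1 hΩ c hcΩ
  obtain ⟨P, hP⟩ := (hg.mono hball).isExactOn_ball
  have heq : (fun z => polyInt g (L z)) =ᶠ[𝓝 c] fun z => P z + (polyInt g (L c) - P c) := by
    filter_upwards [Metric.ball_mem_nhds c hr] with z hz
    have hseg : segment ℝ c z ⊆ Metric.ball c r :=
      (convex_ball c r).segment_subset (Metric.mem_ball_self hr) hz
    -- The chosen chains need not depend continuously on the endpoint: chain to c, segment to z and
    -- reversed chain to z form a cycle.
    have hcyc := ((hL c hcΩ).append (isPolyChain_segment (hseg.trans hball))).append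
      (hL z (hball hz)).swap
    have h0 := polyInt_eq_zero_of_isFull hΩ hfull hg (fun G => by rw [hcyc.2 G, sub_self]) hcyc.1
      hz₀
    rw [polyInt_append, polyInt_append, polyInt_map_swap] at h0
    have h1 : polyInt g [(c, z)] = P z - P c := by
      simpa [polyInt] using segInt_eq_sub_of_hasDerivAt
        (hg.continuousOn.mono (hseg.trans hball)) fun ζ hζ => hP ζ (hseg hζ)
    rw [h1] at h0
    linear_combination -h0
  exact ((hP c (Metric.mem_ball_self hr)).add_const _).congr_of_eventuallyEq heq

/-- If F is a primitive of h'/h, then h·exp(-F) is a constant c², and c·exp(F/2) is a square root.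
-/
theorem hasHolomorphicSqrt_of_isFull {Ω : Set ℂ} (hΩ : IsOpen Ω) (hc : IsPreconnected Ω)
    (hfull : IsFull Ω) : HasHolomorphicSqrt Ω := by
  intro h hd hne
  rcases Ω.eq_empty_or_nonempty with rfl | ⟨z₀, hz₀⟩
  · exact ⟨0, fun z hz => hz.elim, fun z hz => hz.elim⟩
  have hd' : ∀ z ∈ Ω, HasDerivAt h (deriv h z) z := fun z hz =>
    (hd.differentiableAt (hΩ.mem_nhds hz)).hasDerivAt
  obtain ⟨F, hF⟩ := exists_primitive_of_isFull hΩ hc hfull ((hd.deriv hΩ).div hd hne)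
  have hconst : ∀ z ∈ Ω, h z * Complex.exp (-F z) = h z₀ * Complex.exp (-F z₀) := by
    have hder : ∀ z ∈ Ω, HasDerivAt (fun z => h z * Complex.exp (-F z)) 0 z := by
      intro z hz
      refine ((hd' z hz).mul (hF z hz).neg.cexp).congr_deriv ?_
      have := hne z hz
      simp only [Pi.div_apply]
      field_simp
      ring
    intro z hz
    exact hΩ.is_const_of_deriv_eq_zero hc
      (fun z hz => (hder z hz).differentiableAt.differentiableWithinAt)
      (fun z hz => (hder z hz).deriv) hz hz₀
  obtain ⟨c, hc2⟩ := IsAlgClosed.exists_pow_nat_eq (h z₀ * Complex.exp (-F z₀)) (n := 2) two_pos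
  refine ⟨fun z => c * Complex.exp (F z / 2), fun z hz =>
    ((((hF z hz).div_const 2).cexp).const_mul c).differentiableAt.differentiableWithinAt,
    fun z hz => ?_⟩
  rw [mul_pow, hc2, ← hconst z hz, ← Complex.exp_nat_mul, mul_assoc, ← Complex.exp_add]
  simp [mul_div_cancel₀]

end Dixon

/-! ### Invariance of the Fatou set and the components U_n -/

section Fatou

theorem IsTranscendentalEntire.isOpenMap {f : ℂ → ℂ} (hf : IsTranscendentalEntire f) :
    IsOpenMap f := by
  refine (AnalyticOnNhd.is_constant_or_isOpenMap
    (hf.1.differentiableOn.analyticOnNhd isOpen_univ)).resolve_left ?_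
  rintro ⟨w, hw⟩
  exact hf.2 ⟨Polynomial.C w, fun z => by simp [hw z]⟩

theorem IteratesNormalOn.mono {f : ℂ → ℂ} {D D' : Set ℂ} (h : IteratesNormalOn f D)
    (hD : D' ⊆ D) : IteratesNormalOn f D' := by
  intro u
  obtain ⟨φ, hφ, h1 | h1⟩ := h u
  · obtain ⟨g, hg⟩ := h1
    exact ⟨φ, hφ, Or.inl ⟨g, hg.mono hD⟩⟩
  · exact ⟨φ, hφ, Or.inr fun K hK => h1 K (hK.trans hD)⟩

theorem isOpen_fatouSet (f : ℂ → ℂ) : IsOpen (fatouSet f) := by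
  rw [Metric.isOpen_iff]
  rintro z ⟨r, hr, h⟩
  refine ⟨r, hr, fun w hw => ⟨r - dist w z, sub_pos.2 hw, h.mono ?_⟩⟩
  exact Metric.ball_subset_ball' (by linarith)

/-- As f is open, a disc about f(z) lifts by a section σ into a compact part of the disc about z.
Convergence there is uniform, so it passes through σ although σ need not be continuous. -/
theorem map_mem_fatouSet {f : ℂ → ℂ} (hopen : IsOpenMap f) {z : ℂ} (hz : z ∈ fatouSet f) :
    f z ∈ fatouSet f := by
  obtain ⟨r, hr, h⟩ := hz
  have hK : Metric.closedBall z (r / 2) ⊆ Metric.ball z r :=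
    Metric.closedBall_subset_ball (half_lt_self hr)
  obtain ⟨s, hs, hball⟩ := Metric.isOpen_iff.1 (hopen _ Metric.isOpen_ball) (f z)
    ⟨z, Metric.mem_ball_self (half_pos hr), rfl⟩
  have hsec : ∀ w, ∃ v, w ∈ Metric.ball (f z) s → v ∈ Metric.closedBall z (r / 2) ∧ f v = w := by
    intro w
    by_cases hw : w ∈ Metric.ball (f z) s
    · obtain ⟨v, hv, hvw⟩ := hball hw
      exact ⟨v, fun _ => ⟨Metric.ball_subset_closedBall hv, hvw⟩⟩
    · exact ⟨0, fun h => (hw h).elim⟩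
  choose σ hσ using hsec
  refine ⟨s, hs, fun u => ?_⟩
  have hit : ∀ n, ∀ w ∈ Metric.ball (f z) s, f^[n] w = f^[n + 1] (σ w) := fun n w hw => by
    rw [Function.iterate_succ_apply, (hσ w hw).2]
  obtain ⟨φ, hφ, ⟨g, hg⟩ | h1⟩ := h fun k => u k + 1
  · refine ⟨φ, hφ, Or.inl ⟨g ∘ σ, ?_⟩⟩
    have hu := (tendstoLocallyUniformlyOn_iff_forall_isCompact Metric.isOpen_ball).1 hg _ hK
      (isCompact_closedBall _ _)
    rw [Metric.tendstoUniformlyOn_iff] at hu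
    refine TendstoUniformlyOn.tendstoLocallyUniformlyOn ?_
    rw [Metric.tendstoUniformlyOn_iff]
    intro ε hε
    filter_upwards [hu ε hε] with k hk w hw
    rw [hit _ w hw]
    exact hk _ (hσ w hw).1
  · refine ⟨φ, hφ, Or.inr fun K hKs _ M => ?_⟩
    filter_upwards [h1 _ hK (isCompact_closedBall _ _) M] with k hk w hw
    rw [hit _ w (hKs hw)]
    exact hk _ (hσ w (hKs hw)).1

theorem mem_fatouSet_of_map {f : ℂ → ℂ} (hf : Continuous f) {z : ℂ} (hz : f z ∈ fatouSet f) :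
    z ∈ fatouSet f := by
  obtain ⟨r, hr, h⟩ := hz
  obtain ⟨s, hs, hball⟩ := Metric.mem_nhds_iff.1 (hf.continuousAt (Metric.ball_mem_nhds (f z) hr))
  refine ⟨s, hs, fun u => ?_⟩
  -- The index 0 is the only one for which an iterate does not factor through f. If it recurs, the
  -- identity is a constant subsequence; otherwise drop a tail's beginning and lower the indices by
  -- one.
  by_cases h0 : ∃ᶠ k in atTop, u k = 0
  · obtain ⟨φ, hφ, hφ0⟩ := extraction_of_frequently_atTop h0
    refine ⟨φ, hφ, Or.inl ⟨id, ?_⟩⟩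
    simp only [hφ0, Function.iterate_zero]
    refine TendstoUniformlyOn.tendstoLocallyUniformlyOn ?_
    rw [Metric.tendstoUniformlyOn_iff]
    exact fun ε hε => Eventually.of_forall fun k w _ => by simpa using hε
  · rw [not_frequently, eventually_atTop] at h0
    obtain ⟨N, hN⟩ := h0
    obtain ⟨φ, hφ, h1⟩ := h fun k => u (k + N) - 1
    have hit : ∀ k, f^[u (φ k + N)] = f^[u (φ k + N) - 1] ∘ f := fun k => by
      rw [← Function.iterate_succ]
      congr 1
      have := hN (φ k + N) (by omega)
      omega
    refine ⟨fun k => φ k + N, hφ.add_const N, ?_⟩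
    simp only [hit]
    rcases h1 with ⟨g, hg⟩ | h1
    · exact Or.inl ⟨g ∘ f, hg.comp f (fun w hw => hball hw) hf.continuousOn⟩
    · refine Or.inr fun K hKs hKc M => ?_
      filter_upwards [h1 (f '' K) (by rintro _ ⟨w, hw, rfl⟩; exact hball (hKs hw))
        (hKc.image hf) M] with k hk w hw
      exact hk _ (mem_image_of_mem f hw)

theorem isOpenMap_iterate {f : ℂ → ℂ} (hopen : IsOpenMap f) (n : ℕ) : IsOpenMap f^[n] := by
  induction n with
  | zero => exact IsOpenMap.id
  | succ n ih =>
    rw [Function.iterate_succ]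
    exact ih.comp hopen

theorem iterate_mem_fatouSet {f : ℂ → ℂ} (hopen : IsOpenMap f) {z : ℂ} (hz : z ∈ fatouSet f)
    (n : ℕ) : f^[n] z ∈ fatouSet f := by
  induction n with
  | zero => exact hz
  | succ n ih =>
    rw [Function.iterate_succ_apply']
    exact map_mem_fatouSet hopen ih

theorem IsFatouComponent.eq {f : ℂ → ℂ} {U : Set ℂ} (hU : IsFatouComponent f U) {z : ℂ}
    (hz : z ∈ U) : U = connectedComponentIn (fatouSet f) z := by
  obtain ⟨w, -, rfl⟩ := hU
  exact connectedComponentIn_eq hz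

theorem IsFatouComponent.isOpen {f : ℂ → ℂ} {U : Set ℂ} (hU : IsFatouComponent f U) :
    IsOpen U := by
  obtain ⟨w, -, rfl⟩ := hU
  exact (isOpen_fatouSet f).connectedComponentIn

theorem IsFatouComponent.isPreconnected {f : ℂ → ℂ} {U : Set ℂ} (hU : IsFatouComponent f U) :
    IsPreconnected U := by
  obtain ⟨w, -, rfl⟩ := hU
  exact isPreconnected_connectedComponentIn

theorem IsFatouComponent.subset {f : ℂ → ℂ} {U : Set ℂ} (hU : IsFatouComponent f U) :
    U ⊆ fatouSet f := by
  obtain ⟨w, -, rfl⟩ := hU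
  exact connectedComponentIn_subset _ _

theorem IsFatouComponent.nonempty {f : ℂ → ℂ} {U : Set ℂ} (hU : IsFatouComponent f U) :
    U.Nonempty := by
  obtain ⟨w, hw, rfl⟩ := hU
  exact ⟨w, mem_connectedComponentIn hw⟩

theorem isFatouComponent_connectedComponentIn {f : ℂ → ℂ} {z : ℂ} (hz : z ∈ fatouSet f) :
    IsFatouComponent f (connectedComponentIn (fatouSet f) z) := ⟨z, hz, rfl⟩

/-- A Fatou component is closed in the Fatou set. -/
theorem IsFatouComponent.mem_of_mem_closure {f : ℂ → ℂ} {U : Set ℂ} (hU : IsFatouComponent f U)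
    {z : ℂ} (hz : z ∈ closure U) (hzF : z ∈ fatouSet f) : z ∈ U := by
  obtain ⟨w, hw1, hw2⟩ := mem_closure_iff.1 hz _
    (isFatouComponent_connectedComponentIn hzF).isOpen (mem_connectedComponentIn hzF)
  rw [hU.eq hw2, ← connectedComponentIn_eq hw1]
  exact mem_connectedComponentIn hzF

theorem fatouImage_eq {f : ℂ → ℂ} (hf : Continuous f) (hopen : IsOpenMap f) {U : Set ℂ}
    (hU : IsFatouComponent f U) {z : ℂ} (hz : z ∈ U) (n : ℕ) :
    fatouImage f U n = connectedComponentIn (fatouSet f) (f^[n] z) := by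
  have hsub : f^[n] '' U ⊆ connectedComponentIn (fatouSet f) (f^[n] z) := by
    refine (hU.isPreconnected.image _ (hf.iterate n).continuousOn).subset_connectedComponentIn
      (mem_image_of_mem _ hz) ?_
    rintro _ ⟨w, hw, rfl⟩
    exact iterate_mem_fatouSet hopen (hU.subset hw) n
  refine Subset.antisymm (iUnion₂_subset fun w hw => ?_) (subset_iUnion₂_of_subset z hz subset_rfl)
  rw [← connectedComponentIn_eq (hsub (mem_image_of_mem _ hw))]

theorem isFatouComponent_fatouImage {f : ℂ → ℂ} (hf : Continuous f) (hopen : IsOpenMap f)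
    {U : Set ℂ} (hU : IsFatouComponent f U) (n : ℕ) : IsFatouComponent f (fatouImage f U n) := by
  obtain ⟨z, hz⟩ := hU.nonempty
  rw [fatouImage_eq hf hopen hU hz]
  exact isFatouComponent_connectedComponentIn (iterate_mem_fatouSet hopen (hU.subset hz) n)

theorem iterate_mem_fatouImage {f : ℂ → ℂ} (hopen : IsOpenMap f) {U : Set ℂ}
    (hU : IsFatouComponent f U) {z : ℂ} (hz : z ∈ U) (n : ℕ) : f^[n] z ∈ fatouImage f U n :=
  mem_biUnion hz (mem_connectedComponentIn (iterate_mem_fatouSet hopen (hU.subset hz) n))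

theorem mapsTo_fatouImage {f : ℂ → ℂ} (hf : Continuous f) (hopen : IsOpenMap f) {U : Set ℂ}
    (hU : IsFatouComponent f U) (m n : ℕ) :
    MapsTo f^[n] (fatouImage f U m) (fatouImage f U (m + n)) := by
  intro w hw
  obtain ⟨z, hz⟩ := hU.nonempty
  have hm := isFatouComponent_fatouImage hf hopen hU m
  rw [fatouImage_eq hf hopen hU hz, add_comm, Function.iterate_add_apply]
  refine (hm.isPreconnected.image _ (hf.iterate n).continuousOn).subset_connectedComponentIn
    (mem_image_of_mem _ (iterate_mem_fatouImage hopen hU hz m)) ?_ (mem_image_of_mem _ hw)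
  rintro _ ⟨v, hv, rfl⟩
  exact iterate_mem_fatouSet hopen (hm.subset hv) n

theorem fatouImage_zero {f : ℂ → ℂ} (hf : Continuous f) (hopen : IsOpenMap f) {U : Set ℂ}
    (hU : IsFatouComponent f U) : fatouImage f U 0 = U := by
  obtain ⟨z, hz⟩ := hU.nonempty
  rw [fatouImage_eq hf hopen hU hz, Function.iterate_zero, id, ← hU.eq hz]

/-- If some U_n were the plane, it would be the only Fatou component, so U_{n+1} = U_n, and U would
not wander. The Riemann mapping theorem needs this. -/
theorem fatouImage_ne_univ {f : ℂ → ℂ} (hf : Continuous f) (hopen : IsOpenMap f) {U : Set ℂ}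
    (hU : IsWanderingDomain f U) (n : ℕ) : fatouImage f U n ≠ univ := by
  intro h
  have hF : fatouSet f = univ := univ_subset_iff.1 (h ▸
    (isFatouComponent_fatouImage hf hopen hU.1 n).subset)
  refine hU.2 n 1 one_pos ?_
  obtain ⟨z, hz⟩ := hU.1.nonempty
  rw [h, fatouImage_eq hf hopen hU.1 hz, hF, connectedComponentIn_univ,
    PreconnectedSpace.connectedComponent_eq_univ]

end Fatou

/-! ### Baker's argument: boundedness before a non-full component -/

section Baker

/-- Along an ultrafilter the iterates are locally bounded at a point of the Fatou set or tend
to infinity near it. -/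
theorem fatouSet_dichotomy {f : ℂ → ℂ} (hf : Differentiable ℂ f) (u : ℕ → ℕ) {𝒰 : Ultrafilter ℕ}
    (h𝒰 : (𝒰 : Filter ℕ) ≤ atTop) {z : ℂ} (hz : z ∈ fatouSet f) :
    (∃ δ > 0, ∃ M : ℝ, ∀ᶠ k in (𝒰 : Filter ℕ), ∀ w ∈ Metric.ball z δ, ‖f^[u k] w‖ ≤ M) ∨
      ∃ δ > 0, ∀ M : ℝ, ∀ᶠ k in (𝒰 : Filter ℕ), ∀ w ∈ Metric.ball z δ, M < ‖f^[u k] w‖ := by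
  obtain ⟨r, hr, h⟩ := hz
  by_contra! hcon
  obtain ⟨h1, h2⟩ := hcon
  obtain ⟨M₀, hM₀⟩ := h2 (r / 2) (half_pos hr)
  -- Along an ultrafilter both alternatives fail at the same indices: one disc carries values above
  -- n and values below `M₀`. A normal subsequence can do neither in the limit.
  have hP : ∀ n : ℕ, ∃ᶠ k in atTop, (∃ w ∈ Metric.ball z (r / 2), (n : ℝ) < ‖f^[u k] w‖) ∧
      ∃ w ∈ Metric.ball z (r / 2), ‖f^[u k] w‖ ≤ M₀ := by
    intro n
    have ha : ∀ᶠ k in (𝒰 : Filter ℕ), ∃ w ∈ Metric.ball z (r / 2), (n : ℝ) < ‖f^[u k] w‖ :=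
      h1 (r / 2) (half_pos hr) n
    have hb : ∀ᶠ k in (𝒰 : Filter ℕ), ∃ w ∈ Metric.ball z (r / 2), ‖f^[u k] w‖ ≤ M₀ := hM₀
    exact (ha.and hb).frequently.filter_mono h𝒰
  obtain ⟨ψ, -, hψ⟩ := extraction_forall_of_frequently hP
  have hK : Metric.closedBall z (r / 2) ⊆ Metric.ball z r :=
    Metric.closedBall_subset_ball (half_lt_self hr)
  have hcomp := isCompact_closedBall z (r / 2)
  obtain ⟨φ, hφ, ⟨g, hg⟩ | hinf⟩ := h fun k => u (ψ k)
  · have hgd : DifferentiableOn ℂ g (Metric.ball z r) := hg.differentiableOn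
      (Eventually.of_forall fun k => (hf.iterate _).differentiableOn) Metric.isOpen_ball
    obtain ⟨B, hB⟩ := hcomp.exists_bound_of_continuousOn (hgd.continuousOn.mono hK)
    have hu := (tendstoLocallyUniformlyOn_iff_forall_isCompact Metric.isOpen_ball).1 hg _ hK hcomp
    rw [Metric.tendstoUniformlyOn_iff] at hu
    obtain ⟨k, hk1, hk2⟩ := ((hu 1 one_pos).and (eventually_ge_atTop ⌈B + 1⌉₊)).exists
    obtain ⟨⟨w, hw, hlt⟩, -⟩ := hψ (φ k)
    have hwK := Metric.ball_subset_closedBall hw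
    have h3 := hk1 w hwK
    rw [dist_comm, dist_eq_norm] at h3
    have h4 := norm_sub_norm_le (f^[u (ψ (φ k))] w) (g w)
    have h5 : B + 1 ≤ (φ k : ℝ) := (Nat.le_ceil _).trans (by exact_mod_cast hk2.trans (hφ.id_le k))
    linarith [hB w hwK]
  · obtain ⟨k, hk⟩ := (hinf _ hK hcomp M₀).exists
    obtain ⟨-, w, hw, hle⟩ := hψ (φ k)
    exact (hk w (Metric.ball_subset_closedBall hw)).not_ge hle

/-- Along an ultrafilter, the iterates are bounded on a compact subset of a Fatou component, or
tend to infinity uniformly on it. -/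
theorem fatouComponent_dichotomy {f : ℂ → ℂ} (hf : Differentiable ℂ f) (u : ℕ → ℕ)
    {𝒰 : Ultrafilter ℕ} (h𝒰 : (𝒰 : Filter ℕ) ≤ atTop) {W : Set ℂ} (hW : IsFatouComponent f W)
    {Γ : Set ℂ} (hΓ : IsCompact Γ) (hΓW : Γ ⊆ W) :
    (∃ M : ℝ, ∀ᶠ k in (𝒰 : Filter ℕ), ∀ w ∈ Γ, ‖f^[u k] w‖ ≤ M) ∨
      ∀ M : ℝ, ∀ᶠ k in (𝒰 : Filter ℕ), ∀ w ∈ Γ, M < ‖f^[u k] w‖ := by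
  let A : Set ℂ := {z | ∃ δ > 0, ∃ M : ℝ, ∀ᶠ k in (𝒰 : Filter ℕ), ∀ w ∈ Metric.ball z δ,
    ‖f^[u k] w‖ ≤ M}
  let B : Set ℂ := {z | ∃ δ > 0, ∀ M : ℝ, ∀ᶠ k in (𝒰 : Filter ℕ), ∀ w ∈ Metric.ball z δ,
    M < ‖f^[u k] w‖}
  have hsub : ∀ {z w : ℂ} {δ : ℝ}, w ∈ Metric.ball z δ →
      0 < δ - dist w z ∧ Metric.ball w (δ - dist w z) ⊆ Metric.ball z δ := fun h =>
    ⟨sub_pos.2 h, Metric.ball_subset_ball' (by linarith)⟩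
  have hA : IsOpen A := by
    rw [Metric.isOpen_iff]
    rintro z ⟨δ, hδ, M, h⟩
    refine ⟨δ, hδ, fun w hw => ⟨_, (hsub hw).1, M, ?_⟩⟩
    filter_upwards [h] with k hk v hv using hk v ((hsub hw).2 hv)
  have hB : IsOpen B := by
    rw [Metric.isOpen_iff]
    rintro z ⟨δ, hδ, h⟩
    refine ⟨δ, hδ, fun w hw => ⟨_, (hsub hw).1, fun M => ?_⟩⟩
    filter_upwards [h M] with k hk v hv using hk v ((hsub hw).2 hv)
  have hAB : Disjoint A B := by
    rw [Set.disjoint_left]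
    rintro z ⟨δ, hδ, M, h⟩ ⟨δ', hδ', h'⟩
    obtain ⟨k, hk, hk'⟩ := (h.and (h' M)).exists
    exact (hk' z (Metric.mem_ball_self hδ')).not_ge (hk z (Metric.mem_ball_self hδ))
  have hcov : W ⊆ A ∪ B := fun z hz => fatouSet_dichotomy hf u h𝒰 (hW.subset hz)
  have hsplit : W ⊆ A ∨ W ⊆ B := by
    by_cases hne : (W ∩ A).Nonempty
    · exact Or.inl (hW.isPreconnected.subset_left_of_subset_union hA hB hAB hcov hne)
    · refine Or.inr fun z hz => (hcov hz).resolve_left fun h => hne ⟨z, hz, h⟩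
  rcases hsplit with h | h
  · left
    refine hΓ.induction_on (p := fun S => ∃ M : ℝ, ∀ᶠ k in (𝒰 : Filter ℕ), ∀ w ∈ S,
      ‖f^[u k] w‖ ≤ M) ⟨0, by simp⟩ ?_ ?_ fun z hz => ?_
    · rintro s t hst ⟨M, hM⟩
      exact ⟨M, hM.mono fun k hk w hw => hk w (hst hw)⟩
    · rintro s t ⟨M, hM⟩ ⟨M', hM'⟩
      refine ⟨max M M', ?_⟩
      filter_upwards [hM, hM'] with k hk hk' w hw
      exact hw.elim (fun h => (hk w h).trans (le_max_left _ _))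
        fun h => (hk' w h).trans (le_max_right _ _)
    · obtain ⟨δ, hδ, hM⟩ := h (hΓW hz)
      exact ⟨_, mem_nhdsWithin_of_mem_nhds (Metric.ball_mem_nhds z hδ), hM⟩
  · right
    refine hΓ.induction_on (p := fun S => ∀ M : ℝ, ∀ᶠ k in (𝒰 : Filter ℕ), ∀ w ∈ S,
      M < ‖f^[u k] w‖) (by simp) ?_ ?_ fun z hz => ?_
    · intro s t hst hM M
      exact (hM M).mono fun k hk w hw => hk w (hst hw)
    · intro s t hM hM' M
      filter_upwards [hM M, hM' M] with k hk hk' w hw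
      exact hw.elim (hk w) (hk' w)
    · obtain ⟨δ, hδ, hM⟩ := h (hΓW hz)
      exact ⟨_, mem_nhdsWithin_of_mem_nhds (Metric.ball_mem_nhds z hδ), hM⟩

theorem ne_univ_of_isBounded {S : Set ℂ} (h : Bornology.IsBounded S) : S ≠ univ := by
  rintro rfl
  exact NormedSpace.unbounded_univ ℝ ℂ h

/-- If a bounded open set with boundary in a Fatou component is not contained in the component,
then it contains a point of the Julia set. -/
theorem exists_notMem_fatouSet {f : ℂ → ℂ} {W : Set ℂ} (hW : IsFatouComponent f W) {O : Set ℂ}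
    (hO : IsOpen O) (hOb : Bornology.IsBounded O) (hfr : frontier O ⊆ W) (hOW : ¬ O ⊆ W) :
    ∃ p ∈ O, p ∉ fatouSet f := by
  by_contra! hcon
  obtain ⟨q, hqO, hqW⟩ := not_subset.1 hOW
  have hq := isFatouComponent_connectedComponentIn (hcon q hqO)
  set V := connectedComponentIn (fatouSet f) q
  have hqV : q ∈ V := mem_connectedComponentIn (hcon q hqO)
  -- If O lay in the Fatou set, the component `V` of q could not cross the boundary of O and would
  -- be trapped in O. Its own boundary would then consist of Fatou points, yet components are closed
  -- in the Fatou set.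
  have hdisj : ∀ x ∈ V, x ∉ frontier O := fun x hx hxf => by
    have h1 := hW.eq (hfr hxf)
    rw [← hq.eq hx] at h1
    exact hqW (h1 ▸ hqV)
  have hVO : V ⊆ O := by
    refine hq.isPreconnected.subset_left_of_subset_union hO isClosed_closure.isOpen_compl
      (disjoint_compl_right.mono_right (compl_subset_compl.2 subset_closure)) (fun x hx => ?_)
      ⟨q, hqV, hqO⟩
    by_cases hxc : x ∈ closure O
    · left
      by_contra hxO
      exact hdisj x hx (by rw [hO.frontier_eq]; exact ⟨hxc, hxO⟩)
    · exact Or.inr hxc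
  obtain ⟨x, hx⟩ := nonempty_frontier_iff.2 ⟨⟨q, hqV⟩, ne_univ_of_isBounded (hOb.subset hVO)⟩
  have hxF : x ∈ fatouSet f := by
    by_cases hxO : x ∈ O
    · exact hcon x hxO
    · refine hW.subset (hfr ?_)
      rw [hO.frontier_eq]
      exact ⟨closure_mono hVO (frontier_subset_closure hx), hxO⟩
  have := hq.mem_of_mem_closure (frontier_subset_closure hx) hxF
  rw [hq.isOpen.frontier_eq] at hx
  exact hx.2 this

/-- The image of a bounded open set under an open map contains every connected set that it meets
and that avoids the image of the boundary. -/
theorem subset_image_of_disjoint_image_frontier {h : ℂ → ℂ} (hc : Continuous h)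
    (hopen : IsOpenMap h) {O S : Set ℂ} (hO : IsOpen O) (hOb : Bornology.IsBounded O)
    (hS : IsPreconnected S) (hne : (S ∩ h '' O).Nonempty) (hfr : ∀ w ∈ frontier O, h w ∉ S) :
    S ⊆ h '' O := by
  refine hS.subset_left_of_subset_union (hopen O hO)
    ((hOb.isCompact_closure.image hc).isClosed.isOpen_compl)
    (disjoint_compl_right.mono_right (compl_subset_compl.2 (image_mono subset_closure)))
    (fun x hx => ?_) hne
  by_cases hxc : x ∈ h '' closure O
  · left
    obtain ⟨w, hw, rfl⟩ := hxc
    by_contra hn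
    refine hfr w ?_ hx
    rw [hO.frontier_eq]
    exact ⟨hw, fun hwO => hn (mem_image_of_mem h hwO)⟩
  · exact Or.inr hxc

/-- Baker's theorem for wandering domains: if a Fatou component in the orbit is not full, then
the earlier ones are bounded. -/
theorem isBounded_fatouImage_of_not_isFull {f : ℂ → ℂ} (hf : Differentiable ℂ f)
    (hopen : IsOpenMap f) {U : Set ℂ} (hU : IsWanderingDomain f U) {j m : ℕ} (hjm : j < m)
    (hm : ¬ IsFull (fatouImage f U m)) : Bornology.IsBounded (fatouImage f U j) := by
  have hfc := hf.continuous
  have hWm := isFatouComponent_fatouImage hfc hopen hU.1 m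
  have hWj := isFatouComponent_fatouImage hfc hopen hU.1 j
  simp only [IsFull, not_forall] at hm
  obtain ⟨O, hO, hOb, hfr, hOW⟩ := hm
  obtain ⟨p, hpO, hpF⟩ := exists_notMem_fatouSet hWm hO hOb hfr hOW
  obtain ⟨r, hr, hball⟩ := Metric.isOpen_iff.1 hO p hpO
  have hnn : ¬ IteratesNormalOn f (Metric.ball p r) := fun h => hpF ⟨r, hr, h⟩
  simp only [IteratesNormalOn, not_forall, not_exists, not_and, not_or] at hnn
  obtain ⟨u, hu⟩ := hnn
  let 𝒰 : Ultrafilter ℕ := Ultrafilter.of atTop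
  have h𝒰 : (𝒰 : Filter ℕ) ≤ atTop := Ultrafilter.of_le _
  have hΓ : IsCompact (frontier O) :=
    hOb.isCompact_closure.of_isClosed_subset isClosed_frontier frontier_subset_closure
  have hdc : ∀ n, DiffContOnCl ℂ f^[n] O := fun n => (hf.iterate n).diffContOnCl
  -- Bounded on the boundary of O: the maximum principle and Montel contradict non-normality near p.
  rcases fatouComponent_dichotomy hf u h𝒰 hWm hΓ hfr with ⟨M, hM⟩ | hinf
  · exfalso
    have hM' : ∃ᶠ k in atTop, ∀ w ∈ O, ‖f^[u k] w‖ ≤ M := by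
      refine Frequently.filter_mono (Eventually.frequently ?_) h𝒰
      filter_upwards [hM] with k hk w hw
      exact Complex.norm_le_of_forall_mem_frontier_norm_le hOb (hdc _) hk (subset_closure hw)
    obtain ⟨ψ, hψ, hψM⟩ := extraction_of_frequently_atTop hM'
    obtain ⟨φ, hφ, g, hg⟩ := exists_subseq_tendstoLocallyUniformlyOn
      (F := fun k => f^[u (ψ k)]) Metric.isOpen_ball
      (fun k => (hf.iterate _).differentiableOn) fun k w hw => hψM k w (hball hw)
    exact (hu (ψ ∘ φ) (hψ.comp hφ)).1 g hg
  -- Large on the boundary and zero-free in O: the maximum principle for the reciprocals gives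
  -- divergence to infinity on O, again against non-normality.
  by_cases hzero : ∀ᶠ k in (𝒰 : Filter ℕ), ∀ w ∈ O, f^[u k] w ≠ 0
  · exfalso
    have hbig : ∀ n : ℕ, ∃ᶠ k in atTop, ∀ w ∈ O, (n : ℝ) < ‖f^[u k] w‖ := by
      intro n
      refine Frequently.filter_mono (Eventually.frequently ?_) h𝒰
      filter_upwards [hzero, hinf (n + 1)] with k hk hk' w hw
      have hn : (0 : ℝ) < n + 1 := by positivity
      have hne : ∀ v ∈ closure O, f^[u k] v ≠ 0 := by
        intro v hv
        by_cases hvO : v ∈ O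
        · exact hk v hvO
        · have h1 := hk' v (by rw [hO.frontier_eq]; exact ⟨hv, hvO⟩)
          exact norm_pos_iff.1 (hn.trans h1)
      have h2 := Complex.norm_le_of_forall_mem_frontier_norm_le hOb ((hdc (u k)).inv hne)
        (C := ((n : ℝ) + 1)⁻¹) (fun v hv => by
          rw [Pi.inv_apply, norm_inv]
          exact inv_anti₀ hn (hk' v hv).le) (subset_closure hw)
      rw [Pi.inv_apply, norm_inv, inv_le_inv₀ (norm_pos_iff.2 (hk w hw)) hn] at h2
      linarith
    obtain ⟨ψ, hψ, hψM⟩ := extraction_forall_of_frequently hbig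
    refine (hu ψ hψ).2 fun K hK _ M => ?_
    filter_upwards [eventually_ge_atTop ⌈M⌉₊] with k hk w hw
    exact ((Nat.le_ceil M).trans (by exact_mod_cast hk)).trans_lt (hψM k w (hball (hK hw)))
  · have hzero' := Ultrafilter.frequently_iff_eventually.1 (not_eventually.1 hzero)
    obtain ⟨v₀, hv₀⟩ := hWj.nonempty
    obtain ⟨k, hk, hk'⟩ := (hzero'.and (hinf ‖v₀‖)).exists
    push Not at hk
    obtain ⟨w₀, hw₀, hw₀'⟩ := hk
    have hopen' : IsOpenMap f^[u k] := isOpenMap_iterate hopen _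
    have hc' : Continuous f^[u k] := hfc.iterate _
    -- The image of O contains 0 and has its boundary values beyond radius ‖v₀‖, hence covers that
    -- closed disc.
    have hv₀O : v₀ ∈ f^[u k] '' O := by
      refine subset_image_of_disjoint_image_frontier hc' hopen' hO hOb
        (convex_closedBall (0 : ℂ) ‖v₀‖).isPreconnected ⟨0, by simp, w₀, hw₀, hw₀'⟩ ?_ (by simp)
      intro w hw
      rw [mem_closedBall_zero_iff, not_le]
      exact hk' w hw
    refine (hOb.isCompact_closure.image hc').isBounded.subset
      (Subset.trans ?_ (image_mono subset_closure))
    -- The boundary of O is mapped into U_{m + u k}, which differs from U_j by wandering; `j < m`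
    -- covers even `u k = 0`.
    refine subset_image_of_disjoint_image_frontier hc' hopen' hO hOb hWj.isPreconnected
      ⟨v₀, hv₀, hv₀O⟩ fun w hw hwj => ?_
    have h1 := mapsTo_fatouImage hfc hopen hU.1 m (u k) (hfr hw)
    have h2 := (isFatouComponent_fatouImage hfc hopen hU.1 (m + u k)).eq h1
    rw [← hWj.eq hwj] at h2
    refine hU.2 j (m + u k - j) (by omega) ?_
    rw [show j + (m + u k - j) = m + u k by omega, h2]

end Baker

/-! ### Simple connectivity along the orbit -/

section Proper

theorem isPreconnected_annulus {r : ℝ} (hr : 0 ≤ r) :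
    IsPreconnected {z : ℂ | r < ‖z‖ ∧ ‖z‖ < 1} := by
  have h : {z : ℂ | r < ‖z‖ ∧ ‖z‖ < 1} =
      (fun p : ℝ × ℝ => (p.1 : ℂ) * Complex.exp (p.2 * Complex.I)) '' (Ioo r 1 ×ˢ univ) := by
    ext z
    constructor
    · rintro ⟨h1, h2⟩
      exact ⟨(‖z‖, z.arg), ⟨⟨h1, h2⟩, mem_univ _⟩, Complex.norm_mul_exp_arg_mul_I z⟩
    · rintro ⟨p, ⟨⟨h1, h2⟩, -⟩, rfl⟩
      have h3 : ‖(p.1 : ℂ) * Complex.exp (p.2 * Complex.I)‖ = p.1 := by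
        rw [norm_mul, Complex.norm_exp_ofReal_mul_I, mul_one, Complex.norm_real,
          Real.norm_of_nonneg (hr.trans h1.le)]
      exact ⟨by rw [h3]; exact h1, by rw [h3]; exact h2⟩
  rw [h]
  refine ((isPreconnected_Ioo).prod isPreconnected_univ).image _ ?_
  fun_prop

/-- The image of a bounded simply connected Fatou component is full. -/
theorem isFull_of_isBounded_of_isRiemannMap {f : ℂ → ℂ} (hf : Continuous f) (hopen : IsOpenMap f)
    {W W' : Set ℂ} (hW : IsFatouComponent f W) (hW' : IsFatouComponent f W') (hm : MapsTo f W W')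
    (hWb : Bornology.IsBounded W) {ψ φ : ℂ → ℂ} (hR : IsRiemannMap W ψ φ) : IsFull W' := by
  -- This makes f : W → W' proper, as W is bounded: compact sets of W' have compact preimages in W.
  have hcl : ∀ w ∈ closure W, f w ∈ W' → w ∈ W := fun w hw hfw =>
    hW.mem_of_mem_closure hw (mem_fatouSet_of_map hf (hW'.subset hfw))
  have hsurj : W' ⊆ f '' W := by
    refine hW'.isPreconnected.subset_left_of_subset_union (hopen _ hW.isOpen)
      (hWb.isCompact_closure.image hf).isClosed.isOpen_compl
      (disjoint_compl_right.mono_right (compl_subset_compl.2 (image_mono subset_closure)))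
      (fun x hx => ?_) ?_
    · by_cases hxc : x ∈ f '' closure W
      · obtain ⟨w, hw, rfl⟩ := hxc
        exact Or.inl (mem_image_of_mem f (hcl w hw hx))
      · exact Or.inr hxc
    · obtain ⟨w, hw⟩ := hW.nonempty
      exact ⟨f w, hm hw, w, hw, rfl⟩
  intro O hO hOb hfr
  by_contra hOW
  have hΓ : IsCompact (frontier O) :=
    hOb.isCompact_closure.of_isClosed_subset isClosed_frontier frontier_subset_closure
  have hKW : closure W ∩ f ⁻¹' frontier O ⊆ W := fun w hw => hcl w hw.1 (hfr hw.2)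
  have hK : IsCompact (closure W ∩ f ⁻¹' frontier O) :=
    hWb.isCompact_closure.inter_right (hΓ.isClosed.preimage hf)
  have hψK : IsCompact (ψ '' (closure W ∩ f ⁻¹' frontier O)) :=
    hK.image_of_continuousOn (hR.diff.continuousOn.mono hKW)
  obtain ⟨r, hr0, hr1, hr⟩ : ∃ r, 0 ≤ r ∧ r < 1 ∧
      ∀ w ∈ closure W ∩ f ⁻¹' frontier O, ‖ψ w‖ ≤ r := by
    rcases (closure W ∩ f ⁻¹' frontier O).eq_empty_or_nonempty with he | hne
    · exact ⟨0, le_rfl, one_pos, by simp [he]⟩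
    · obtain ⟨w, hw, hmax⟩ := hK.exists_isMaxOn hne (hR.diff.continuousOn.mono hKW).norm
      exact ⟨‖ψ w‖, norm_nonneg _, by simpa using hR.mapsTo (hKW hw), fun v hv => hmax hv⟩
  -- The preimage of the boundary of O lies in the part |ψ| ≤ r, so the connected image `V` of the
  -- annulus avoids that boundary. It must lie in O or outside its closure; both are excluded next.
  let A : Set ℂ := {z | r < ‖z‖ ∧ ‖z‖ < 1}
  have hAb : A ⊆ Metric.ball 0 1 := fun z hz => by simpa using hz.2
  let V : Set ℂ := f '' (φ '' A)
  have hV : IsPreconnected V :=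
    ((isPreconnected_annulus hr0).image _ (hR.diff_symm.continuousOn.mono hAb)).image _
      hf.continuousOn
  have hVfr : ∀ v ∈ V, v ∉ frontier O := by
    rintro _ ⟨_, ⟨a, ha, rfl⟩, rfl⟩ hv
    have := hr (φ a) ⟨subset_closure (hR.mapsTo_symm (hAb ha)), hv⟩
    rw [hR.right_inv a (hAb ha)] at this
    exact this.not_gt ha.1
  have hcb : Metric.closedBall (0 : ℂ) r ⊆ Metric.ball 0 1 := Metric.closedBall_subset_ball hr1
  let C : Set ℂ := f '' (φ '' Metric.closedBall 0 r)
  have hC : IsCompact C := ((isCompact_closedBall _ _).image_of_continuousOn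
    (hR.diff_symm.continuousOn.mono hcb)).image hf
  have hCW : C ⊆ W' := by
    rintro _ ⟨_, ⟨a, ha, rfl⟩, rfl⟩
    exact hm (hR.mapsTo_symm (hcb ha))
  have hcov : W' ⊆ C ∪ V := by
    intro x hx
    obtain ⟨w, hw, rfl⟩ := hsurj hx
    have h1 : ‖ψ w‖ < 1 := by simpa using hR.mapsTo hw
    rcases le_or_gt ‖ψ w‖ r with h | h
    · exact Or.inl ⟨w, ⟨ψ w, by simpa using h, hR.left_inv w hw⟩, rfl⟩
    · exact Or.inr ⟨w, ⟨ψ w, ⟨h, h1⟩, hR.left_inv w hw⟩, rfl⟩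
  obtain ⟨q, hqO, hqW⟩ := not_subset.1 hOW
  -- Otherwise O ∩ W' lies in the compact set C. Every boundary point of O \ C is in W', so W' meets
  -- O \ C, a contradiction.
  have hVO : (V ∩ O).Nonempty := by
    by_contra hemp
    have hOC : ∀ x ∈ O, x ∈ W' → x ∈ C := fun x hxO hxW =>
      (hcov hxW).resolve_right fun h => hemp ⟨x, h, hxO⟩
    obtain ⟨x, hx⟩ := (nonempty_frontier_iff (s := O \ C)).2 ⟨⟨q, hqO, fun h => hqW (hCW h)⟩,
      ne_univ_of_isBounded (hOb.subset (sdiff_subset (t := C)))⟩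
    have hopenD : IsOpen (O \ C) := hO.sdiff hC.isClosed
    rw [hopenD.frontier_eq] at hx
    have hxW : x ∈ W' := by
      by_cases hxO : x ∈ O
      · by_contra h
        exact hx.2 ⟨hxO, fun hc => h (hCW hc)⟩
      · refine hfr ?_
        rw [hO.frontier_eq]
        exact ⟨closure_mono sdiff_subset hx.1, hxO⟩
    obtain ⟨y, hyW, hyO, hyC⟩ := mem_closure_iff.1 hx.1 _ hW'.isOpen hxW
    exact hyC (hOC y hyO hyW)
  -- Otherwise W' ∪ O = C ∪ closure O would be open, compact and nonempty in the plane.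
  have hVO' : (V ∩ (closure O)ᶜ).Nonempty := by
    by_contra hemp
    have hsub : W' ∪ O = C ∪ closure O := by
      refine Subset.antisymm (union_subset (fun x hx => ?_)
        (subset_closure.trans subset_union_right)) (union_subset (hCW.trans subset_union_left) ?_)
      · refine (hcov hx).imp id fun h => ?_
        by_contra hn
        exact hemp ⟨x, h, hn⟩
      · intro x hx
        by_cases hxO : x ∈ O
        · exact Or.inr hxO
        · refine Or.inl (hfr ?_)
          rw [hO.frontier_eq]
          exact ⟨hx, hxO⟩
    have hcomp : IsCompact (W' ∪ O) := hsub ▸ hC.union hOb.isCompact_closure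
    have hclopen : IsClopen (W' ∪ O) := ⟨hcomp.isClosed, hW'.isOpen.union hO⟩
    rcases isClopen_iff.1 hclopen with h | h
    · exact (h ▸ (Or.inr hqO : q ∈ W' ∪ O) : q ∈ (∅ : Set ℂ))
    · exact ne_univ_of_isBounded hcomp.isBounded h
  have hsub : V ⊆ O := by
    refine hV.subset_left_of_subset_union hO isClosed_closure.isOpen_compl
      (disjoint_compl_right.mono_right (compl_subset_compl.2 subset_closure)) (fun x hx => ?_) hVO
    by_cases hxc : x ∈ closure O
    · left
      by_contra hxO
      exact hVfr x hx (by rw [hO.frontier_eq]; exact ⟨hxc, hxO⟩)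
    · exact Or.inr hxc
  obtain ⟨x, hxV, hxO⟩ := hVO'
  exact hxO (subset_closure (hsub hxV))

/-- Simple connectivity gives a continuous square root s; it is holomorphic because its difference
quotient is that of g divided by s(w) + s(z). -/
theorem hasHolomorphicSqrt_of_isSimplyConnected {Ω : Set ℂ} (hΩ : IsOpen Ω)
    (hsc : IsSimplyConnected Ω) : HasHolomorphicSqrt Ω := by
  intro g hg hne
  obtain ⟨s, hsc, hs⟩ := Complex.exists_continuousOn_pow_eq hsc hΩ hg.continuousOn
    (by rintro ⟨z, hz, h⟩; exact hne z hz h) two_ne_zero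
  refine ⟨s, fun z hz => ?_, fun z _ => hs z⟩
  have hsz : ContinuousAt s z := hsc.continuousAt (hΩ.mem_nhds hz)
  have hs0 : s z + s z ≠ 0 := fun h => hne z hz (by
    rw [← hs z, show s z = 0 by linear_combination h / 2]; simp)
  have hlim : Tendsto (fun w => slope g z w / (s w + s z)) (𝓝[≠] z)
      (𝓝 (deriv g z / (s z + s z))) :=
    (hasDerivAt_iff_tendsto_slope.1 (hg.differentiableAt (hΩ.mem_nhds hz)).hasDerivAt).div
      ((hsz.tendsto.mono_left nhdsWithin_le_nhds).add_const _) hs0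
  have hev : ∀ᶠ w in 𝓝[≠] z, s w + s z ≠ 0 := by
    refine eventually_nhdsWithin_of_eventually_nhds ?_
    exact (hsz.add_const (s z)).eventually_ne hs0
  refine (hasDerivAt_iff_tendsto_slope.2 (hlim.congr' ?_)).differentiableAt.differentiableWithinAt
  filter_upwards [hev, self_mem_nhdsWithin] with w hw hwz
  have hwz' : w - z ≠ 0 := sub_ne_zero.2 hwz
  rw [slope_def_field, slope_def_field, ← hs w, ← hs z]
  field_simp
  ring

/-- All Fatou components in the orbit of a simply connected wandering domain are conformally
equivalent to the disc. -/
theorem exists_isRiemannMap_fatouImage {f : ℂ → ℂ} (hf : Differentiable ℂ f)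
    (hopen : IsOpenMap f) {U : Set ℂ} (hU : IsWanderingDomain f U) (hsc : IsSimplyConnected U)
    (n : ℕ) {z : ℂ} (hz : z ∈ fatouImage f U n) :
    ∃ ψ φ : ℂ → ℂ, IsRiemannMap (fatouImage f U n) ψ φ ∧ ψ z = 0 := by
  have hfc := hf.continuous
  have hcomp := isFatouComponent_fatouImage hfc hopen hU.1
  suffices hs : HasHolomorphicSqrt (fatouImage f U n) from
    exists_isRiemannMap (hcomp n).isOpen (hcomp n).isPreconnected
      (fatouImage_ne_univ hfc hopen hU n) hs hz
  clear hz z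
  induction n with
  | zero =>
    rw [fatouImage_zero hfc hopen hU.1]
    exact hasHolomorphicSqrt_of_isSimplyConnected hU.1.isOpen hsc
  | succ n ih =>
    refine hasHolomorphicSqrt_of_isFull (hcomp _).isOpen (hcomp _).isPreconnected ?_
    by_contra hfull
    obtain ⟨z, hz⟩ := (hcomp n).nonempty
    obtain ⟨ψ, φ, hR, -⟩ := exists_isRiemannMap (hcomp n).isOpen (hcomp n).isPreconnected
      (fatouImage_ne_univ hfc hopen hU n) ih hz
    exact hfull (isFull_of_isBounded_of_isRiemannMap hfc hopen (hcomp n) (hcomp (n + 1))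
      (mapsTo_fatouImage hfc hopen hU.1 n 1)
      (isBounded_fatouImage_of_not_isFull hf hopen hU n.lt_succ_self hfull) hR)

end Proper

/-! ### Quantitative and rigid forms of the Schwarz lemma -/

section DiscEstimates

/-- Points at bounded pseudo-hyperbolic distance have comparable distances to the unit circle.
Inserting |1 - āb| ≥ 1 - |a| into `one_sub_norm_mob_sq` leaves the factor (1 + |a|)(1 + |b|) ≤ 4. -/
theorem one_sub_norm_comparison {a b : ℂ} {r : ℝ} (ha : ‖a‖ < 1) (hb : ‖b‖ < 1)
    (h : ‖mob a b‖ ≤ r) (hr : r < 1) : (1 - r ^ 2) / 4 * (1 - ‖a‖) ≤ 1 - ‖b‖ := by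
  have key := one_sub_norm_mob_sq ha hb.le
  have h1 : 1 - ‖a‖ ≤ ‖1 - (starRingEnd ℂ) a * b‖ := by
    have h2 := norm_sub_norm_le 1 ((starRingEnd ℂ) a * b)
    rw [norm_one, norm_mul, RCLike.norm_conj] at h2
    nlinarith [norm_nonneg a, norm_nonneg b]
  have h0 := norm_nonneg (mob a b)
  have ha0 := norm_nonneg a
  have hb0 := norm_nonneg b
  set x := ‖a‖
  set y := ‖b‖
  set D := ‖1 - (starRingEnd ℂ) a * b‖
  have h3 : 1 - r ^ 2 ≤ 1 - ‖mob a b‖ ^ 2 := by nlinarith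
  have h4 : 0 < 1 - r ^ 2 := by nlinarith
  have h5 : (1 - x) ^ 2 ≤ D ^ 2 := by nlinarith
  have h6 : (1 - r ^ 2) * (1 - x) ^ 2 ≤ (1 - x ^ 2) * (1 - y ^ 2) := by
    rw [← key]
    exact mul_le_mul h3 h5 (by positivity) (by linarith)
  have h7 : (1 - r ^ 2) * (1 - x) ≤ (1 + x) * (1 - y ^ 2) := by
    have hx : 0 < 1 - x := by linarith
    refine le_of_mul_le_mul_left ?_ hx
    nlinarith
  nlinarith [mul_nonneg (sub_nonneg.2 ha.le) (sub_nonneg.2 hb.le)]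

variable {g : ℂ → ℂ}

theorem norm_dslope_le_one (hg : DifferentiableOn ℂ g (Metric.ball 0 1))
    (hm : MapsTo g (Metric.ball 0 1) (Metric.ball 0 1)) (h0 : g 0 = 0) {w : ℂ} (hw : ‖w‖ < 1) :
    ‖dslope g 0 w‖ ≤ 1 := by
  simpa using Complex.norm_dslope_le_div_of_mapsTo_ball hg
    (by rw [h0]; exact hm.mono_right Metric.ball_subset_closedBall) (mem_ball_zero_iff.2 hw)

theorem differentiableOn_dslope_ball (hg : DifferentiableOn ℂ g (Metric.ball 0 1)) :
    DifferentiableOn ℂ (dslope g 0) (Metric.ball 0 1) :=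
  (Complex.differentiableOn_dslope (Metric.ball_mem_nhds 0 one_pos)).2 hg

theorem dslope_eq_of_norm_eq_one (hg : DifferentiableOn ℂ g (Metric.ball 0 1))
    (hm : MapsTo g (Metric.ball 0 1) (Metric.ball 0 1)) (h0 : g 0 = 0) {a w : ℂ} (ha : ‖a‖ < 1)
    (h : ‖dslope g 0 a‖ = 1) (hw : ‖w‖ < 1) : dslope g 0 w = dslope g 0 a := by
  refine Complex.eqOn_of_isPreconnected_of_isMaxOn_norm (convex_ball (0 : ℂ) 1).isPreconnected
    Metric.isOpen_ball (differentiableOn_dslope_ball hg) (mem_ball_zero_iff.2 ha) (fun x hx => ?_)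
    (mem_ball_zero_iff.2 hw)
  simpa [h] using norm_dslope_le_one hg hm h0 (mem_ball_zero_iff.1 hx)

/-- The key estimate: g(w)/w is itself a disc self-map unless it is a unimodular constant, so
Schwarz–Pick bounds the pseudo-hyperbolic distance of its values at 0 and w by |w| ≤ r. The constant
does not depend on g. -/
theorem dslope_estimates (hg : DifferentiableOn ℂ g (Metric.ball 0 1))
    (hm : MapsTo g (Metric.ball 0 1) (Metric.ball 0 1)) (h0 : g 0 = 0) {r : ℝ} (hr : r < 1) {w : ℂ}
    (hw : ‖w‖ ≤ r) :
    (1 - r ^ 2) / 4 * (1 - ‖deriv g 0‖) ≤ 1 - ‖dslope g 0 w‖ ∧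
      (1 - r ^ 2) / 4 * (1 - ‖dslope g 0 w‖) ≤ 1 - ‖deriv g 0‖ := by
  have hw1 : ‖w‖ < 1 := hw.trans_lt hr
  rw [← dslope_same g 0]
  by_cases hone : ∃ a : ℂ, ‖a‖ < 1 ∧ ‖dslope g 0 a‖ = 1
  · obtain ⟨a, ha, ha1⟩ := hone
    rw [dslope_eq_of_norm_eq_one hg hm h0 ha ha1 hw1,
      dslope_eq_of_norm_eq_one hg hm h0 ha ha1 (w := 0) (by simp), ha1]
    simp
  · push Not at hone
    have hlt : ∀ a : ℂ, ‖a‖ < 1 → ‖dslope g 0 a‖ < 1 := fun a ha =>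
      lt_of_le_of_ne (norm_dslope_le_one hg hm h0 ha) (hone a ha)
    have hpick := norm_mob_le_of_mapsTo_ball (differentiableOn_dslope_ball hg)
      (fun a ha => mem_ball_zero_iff.2 (hlt a (mem_ball_zero_iff.1 ha))) (a := 0) (b := w)
      (by simp) hw1
    have h1 : ‖mob 0 w‖ = ‖w‖ := by simp [mob]
    rw [h1] at hpick
    have hz : ‖(0 : ℂ)‖ < 1 := by simp
    exact ⟨one_sub_norm_comparison (hlt 0 hz) (hlt w hw1) (hpick.trans hw) hr,
      one_sub_norm_comparison (hlt w hw1) (hlt 0 hz)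
        ((norm_mob_comm _ _).le.trans (hpick.trans hw)) hr⟩

theorem eq_mul_dslope (h0 : g 0 = 0) (w : ℂ) : g w = w * dslope g 0 w := by
  have := sub_smul_dslope g 0 w
  rw [h0, sub_zero, sub_zero, smul_eq_mul] at this
  exact this.symm

/-- By the equality case of Schwarz, g is a rotation, hence an isometry for all pairs and not only
those containing 0. -/
theorem norm_mob_eq_of_norm_deriv_eq_one (hg : DifferentiableOn ℂ g (Metric.ball 0 1))
    (hm : MapsTo g (Metric.ball 0 1) (Metric.ball 0 1)) (h0 : g 0 = 0) (h1 : ‖deriv g 0‖ = 1)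
    {a b : ℂ} (ha : ‖a‖ < 1) (hb : ‖b‖ < 1) : ‖mob (g a) (g b)‖ = ‖mob a b‖ := by
  rw [← dslope_same g 0] at h1
  have hz : ‖(0 : ℂ)‖ < 1 := by simp
  rw [eq_mul_dslope h0 a, eq_mul_dslope h0 b, dslope_eq_of_norm_eq_one hg hm h0 hz h1 ha,
    dslope_eq_of_norm_eq_one hg hm h0 hz h1 hb]
  set c := dslope g 0 0
  have hc : (starRingEnd ℂ) c * c = 1 := by
    rw [mul_comm, Complex.mul_conj, Complex.normSq_eq_norm_sq, h1]
    simp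
  have hmob : mob (a * c) (b * c) = mob a b * c := by
    rw [mob, mob, map_mul, show (starRingEnd ℂ) a * (starRingEnd ℂ) c * (b * c) =
      (starRingEnd ℂ) a * b * ((starRingEnd ℂ) c * c) by ring, hc]
    ring
  rw [hmob, norm_mul, h1, mul_one]

end DiscEstimates

/-! ### Infinite products against series -/

section Sequences

variable {t κ l : ℕ → ℝ} {c : ℝ}

/-- Each factor satisfies κ ≤ 1 - c(1 - l) ≤ exp(-c(1 - l)); the exponents add up to -∞. -/
theorem tendsto_zero_of_sum_tendsto_atTop (ht : ∀ n, 0 ≤ t n) (hstep : ∀ n, t (n + 1) = t n * κ n)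
    (hc : 0 < c) (hκ : ∀ n, c * (1 - l n) ≤ 1 - κ n)
    (hsum : Tendsto (fun m => ∑ n ∈ Finset.range m, (1 - l n)) atTop atTop) :
    Tendsto t atTop (𝓝 0) := by
  have hbound : ∀ m, t m ≤ t 0 * Real.exp (-(c * ∑ n ∈ Finset.range m, (1 - l n))) := by
    intro m
    induction m with
    | zero => simp
    | succ m ih =>
      rw [Finset.sum_range_succ, mul_add, neg_add, Real.exp_add, ← mul_assoc, hstep]
      have h1 : κ m ≤ Real.exp (-(c * (1 - l m))) := by
        have := Real.add_one_le_exp (-(c * (1 - l m)))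
        linarith [hκ m]
      calc t m * κ m ≤ t m * Real.exp (-(c * (1 - l m))) := mul_le_mul_of_nonneg_left h1 (ht m)
        _ ≤ _ := mul_le_mul_of_nonneg_right ih (Real.exp_nonneg _)
  refine squeeze_zero ht hbound ?_
  have h2 := Real.tendsto_exp_neg_atTop_nhds_zero.comp (hsum.const_mul_atTop hc)
  simpa [Function.comp_def] using h2.const_mul (t 0)

/-- Past an index N where the tail sum is below c/2, the inequality ∏(1 - x_k) ≥ 1 - Σ x_k with x_k
= (1 - l_k)/c keeps t above t_N/2. -/
theorem exists_pos_le_of_summable (ht : ∀ n, 0 < t n) (hstep : ∀ n, t (n + 1) = t n * κ n)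
    (hc : 0 < c) (hκ : ∀ n, c * (1 - κ n) ≤ 1 - l n) (hl : ∀ n, l n ≤ 1)
    (hsum : Summable fun n => 1 - l n) : ∃ ε > 0, ∀ᶠ n in atTop, ε ≤ t n := by
  obtain ⟨N, hN⟩ : ∃ N, ∑' k, (1 - l (k + N)) < c / 2 := by
    have := tendsto_sum_nat_add fun n => 1 - l n
    exact (this.eventually (gt_mem_nhds (half_pos hc))).exists
  have hsumN : Summable fun k => 1 - l (k + N) := (summable_nat_add_iff N).2 hsum
  have hpart : ∀ m, ∑ k ∈ Finset.range m, (1 - l (k + N)) < c / 2 := fun m =>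
    (hsumN.sum_le_tsum _ fun k _ => sub_nonneg.2 (hl _)).trans_lt hN
  have hlow : ∀ m, t N * (1 - (∑ k ∈ Finset.range m, (1 - l (k + N))) / c) ≤ t (m + N) := by
    intro m
    induction m with
    | zero => simp
    | succ m ih =>
      rw [Finset.sum_range_succ, show m + 1 + N = m + N + 1 by ring, hstep]
      set S := ∑ k ∈ Finset.range m, (1 - l (k + N)) with hS
      have hS0 : 0 ≤ S := Finset.sum_nonneg fun k _ => sub_nonneg.2 (hl _)
      have hS1 : S < c / 2 := hpart m
      have h1 : 1 - (1 - l (m + N)) / c ≤ κ (m + N) := by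
        have := hκ (m + N)
        rw [mul_comm, ← le_div_iff₀ hc] at this
        linarith
      have h2 : (S + (1 - l (m + N))) / c < 1 := by
        have := hpart (m + 1)
        rw [Finset.sum_range_succ] at this
        rw [div_lt_one hc]
        linarith
      have h3 : 0 ≤ (1 - l (m + N)) / c := div_nonneg (sub_nonneg.2 (hl _)) hc.le
      have h4 : 0 ≤ S / c := div_nonneg hS0 hc.le
      rw [add_div] at h2 ⊢
      have h5 : 0 ≤ 1 - (1 - l (m + N)) / c := by linarith
      calc t N * (1 - (S / c + (1 - l (m + N)) / c))
          ≤ t N * ((1 - S / c) * (1 - (1 - l (m + N)) / c)) := by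
            refine mul_le_mul_of_nonneg_left ?_ (ht N).le
            nlinarith [mul_nonneg h4 h3]
        _ = t N * (1 - S / c) * (1 - (1 - l (m + N)) / c) := by ring
        _ ≤ t (m + N) * (1 - (1 - l (m + N)) / c) := mul_le_mul_of_nonneg_right ih h5
        _ ≤ t (m + N) * κ (m + N) := mul_le_mul_of_nonneg_left h1 (ht _).le
  refine ⟨t N / 2, half_pos (ht N), eventually_atTop.2 ⟨N, fun n hn => ?_⟩⟩
  obtain ⟨m, rfl⟩ := Nat.exists_eq_add_of_le' hn
  refine le_trans ?_ (hlow m)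
  have h6 : (∑ k ∈ Finset.range m, (1 - l (k + N))) / c ≤ 1 / 2 := by
    rw [div_le_iff₀ hc]
    linarith [hpart m]
  nlinarith [ht N]

end Sequences

/-! ### Hyperbolic distance and distortion through a Riemann map -/

section HyperbolicDistance

/-- Hyperbolic distance in the disc as a function of the pseudo-hyperbolic distance. -/
noncomputable def hypL (t : ℝ) : ℝ := Real.log ((1 + t) / (1 - t))

theorem hypL_zero : hypL 0 = 0 := by simp [hypL]

theorem hypL_strictMonoOn : StrictMonoOn hypL (Ico 0 1) := by
  intro s hs t ht hst
  have h1 : 0 < 1 - s := by linarith [hs.2]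
  have h2 : 0 < 1 - t := by linarith [ht.2]
  have h3 : 0 < 1 + s := by linarith [hs.1]
  refine Real.log_lt_log (by positivity) ?_
  rw [div_lt_div_iff₀ h1 h2]
  nlinarith

theorem hasDerivAt_hypL_zero : HasDerivAt hypL 2 0 := by
  have h1 := (((hasDerivAt_id (0 : ℝ)).const_add 1).fun_div ((hasDerivAt_id (0 : ℝ)).const_sub 1)
    (by simp)).log (by simp)
  refine h1.congr_deriv ?_
  norm_num

theorem discDist_eq (a b : ℂ) : discDist a b = hypL ‖mob a b‖ := by
  have : ‖(a - b) / (1 - (starRingEnd ℂ) a * b)‖ = ‖mob a b‖ := by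
    rw [mob, norm_div, norm_div, norm_sub_rev]
  rw [discDist, this, hypL]

theorem norm_mob_mem {a b : ℂ} (ha : ‖a‖ < 1) (hb : ‖b‖ < 1) : ‖mob a b‖ ∈ Ico (0 : ℝ) 1 :=
  ⟨norm_nonneg _, norm_mob_lt_one ha hb⟩

theorem isCoveringMap_of_homeomorph {X Y : Type*} [TopologicalSpace X] [TopologicalSpace Y]
    (e : X ≃ₜ Y) : IsCoveringMap e := fun y =>
  IsEvenlyCovered.to_isEvenlyCovered_preimage (I := PUnit.{1})
    ⟨inferInstance, univ, mem_univ y, isOpen_univ, isOpen_univ,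
      (Homeomorph.Set.univ X).trans (e.trans ((Homeomorph.Set.univ Y).symm.trans
        (Homeomorph.prodPUnit (univ : Set Y)).symm)), fun _ => rfl⟩

theorem IsRiemannMap.isUniversalCovering {Ω : Set ℂ} {ψ φ : ℂ → ℂ} (hR : IsRiemannMap Ω ψ φ) :
    IsUniversalCovering φ Ω := by
  refine ⟨hR.diff_symm, fun z hz => ⟨ψ z, hR.mapsTo hz, hR.left_inv z hz⟩, hR.mapsTo_symm, ?_⟩
  let e : Metric.ball (0 : ℂ) 1 ≃ₜ Ω :=
    { toFun := hR.mapsTo_symm.restrict φ (Metric.ball 0 1) Ω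
      invFun := hR.mapsTo.restrict ψ Ω (Metric.ball 0 1)
      left_inv := fun w => Subtype.ext (hR.right_inv w w.2)
      right_inv := fun z => Subtype.ext (hR.left_inv z z.2)
      continuous_toFun := hR.diff_symm.continuousOn.mapsToRestrict _
      continuous_invFun := hR.diff.continuousOn.mapsToRestrict _ }
  exact isCoveringMap_of_homeomorph e

/-- The infimum is attained by φ: for any other covering π, ψ ∘ π is a disc self-map, which by
Schwarz–Pick does not increase distances. -/
theorem IsRiemannMap.hypDist_eq {Ω : Set ℂ} {ψ φ : ℂ → ℂ} (hR : IsRiemannMap Ω ψ φ) {z w : ℂ}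
    (hz : z ∈ Ω) (hw : w ∈ Ω) : hypDist Ω z w = hypL ‖mob (ψ z) (ψ w)‖ := by
  refine IsLeast.csInf_eq ⟨⟨φ, hR.isUniversalCovering, ψ z, hR.mapsTo hz, ψ w, hR.mapsTo hw,
    hR.left_inv z hz, hR.left_inv w hw, (discDist_eq _ _).symm⟩, ?_⟩
  rintro _ ⟨π, ⟨hπd, -, hπm, -⟩, a, ha, b, hb, rfl, rfl, rfl⟩
  rw [mem_ball_zero_iff] at ha hb
  rw [discDist_eq]
  have hm := hR.mapsTo.comp hπm
  refine hypL_strictMonoOn.monotoneOn ?_ (norm_mob_mem ha hb)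
    (norm_mob_le_of_mapsTo_ball (hR.diff.comp hπd hπm) hm ha hb)
  exact norm_mob_mem (mem_ball_zero_iff.1 (hR.mapsTo hz)) (mem_ball_zero_iff.1 (hR.mapsTo hw))

/-- To first order `hypL t` is 2t at 0; the factor 2 cancels and the difference quotient of g
remains. -/
theorem tendsto_hypL_ratio {g : ℂ → ℂ} (hg : DifferentiableAt ℂ g 0) (h0 : g 0 = 0) :
    Tendsto (fun x => hypL ‖g x‖ / hypL ‖x‖) (𝓝[≠] 0) (𝓝 ‖deriv g 0‖) := by
  have hK : ContinuousAt (dslope hypL 0) 0 :=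
    continuousAt_dslope_same.2 hasDerivAt_hypL_zero.differentiableAt
  have hK0 : dslope hypL 0 0 = 2 := by rw [dslope_same, hasDerivAt_hypL_zero.deriv]
  have hmul : ∀ t, hypL t = t * dslope hypL 0 t := fun t => by
    have := sub_smul_dslope hypL 0 t
    rw [hypL_zero, sub_zero, sub_zero, smul_eq_mul] at this
    exact this.symm
  have hx : Tendsto (fun x : ℂ => ‖x‖) (𝓝[≠] 0) (𝓝 0) :=
    tendsto_norm_zero.mono_left nhdsWithin_le_nhds
  have hgx : Tendsto (fun x : ℂ => ‖g x‖) (𝓝[≠] 0) (𝓝 0) := by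
    have := hg.continuousAt.norm.tendsto
    rw [h0, norm_zero] at this
    exact this.mono_left nhdsWithin_le_nhds
  have hK' : Tendsto (dslope hypL 0) (𝓝 0) (𝓝 2) := hK0 ▸ hK.tendsto
  have hsl := (hasDerivAt_iff_tendsto_slope.1 hg.hasDerivAt).norm
  have hlim := hsl.mul ((hK'.comp hgx).div (hK'.comp hx) two_ne_zero)
  rw [div_self two_ne_zero, mul_one] at hlim
  refine hlim.congr fun x => ?_
  rw [hmul ‖g x‖, hmul ‖x‖, slope_def_field, h0, sub_zero, sub_zero, norm_div]
  exact div_mul_div_comm _ _ _ _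

end HyperbolicDistance

/-! ### The orbit as a sequence of disc maps -/

section OrbitModel

/-- The orbit of a wandering domain `U` seen through Riemann maps of the domains `U_n` that send
`f^n(z)` to `0`: `g n` is `f : U_n → U_{n+1}` and `w n` is `f^n` on `U`, both read in the disc. -/
structure DiscModel (f : ℂ → ℂ) (U : Set ℂ) (z : ℂ) (g w : ℕ → ℂ → ℂ) : Prop where
  diff : ∀ n, DifferentiableOn ℂ (g n) (Metric.ball 0 1)
  mapsTo : ∀ n, MapsTo (g n) (Metric.ball 0 1) (Metric.ball 0 1)
  map_zero : ∀ n, g n 0 = 0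
  norm_lt : ∀ n, ∀ x ∈ U, ‖w n x‖ < 1
  base : ∀ n, w n z = 0
  step : ∀ n, ∀ x ∈ U, w (n + 1) x = g n (w n x)
  inj : ∀ n, ∀ x ∈ U, ∀ y ∈ U, w n x = w n y → f^[n] x = f^[n] y
  orbitDist_eq : ∀ n, ∀ x ∈ U, ∀ y ∈ U, orbitDist f U n x y = hypL ‖mob (w n x) (w n y)‖
  distortion : ∀ n,
    HasHypDistortion f (fatouImage f U n) (fatouImage f U (n + 1)) (f^[n] z) ‖deriv (g n) 0‖

theorem IsRiemannMap.hasHypDistortion {f : ℂ → ℂ} {Ω Ω' : Set ℂ} {ψ φ ψ' φ' : ℂ → ℂ}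
    (hR : IsRiemannMap Ω ψ φ) (hR' : IsRiemannMap Ω' ψ' φ') (hΩ : IsOpen Ω)
    (hf : MapsTo f Ω Ω') {z : ℂ} (hz : z ∈ Ω) (hψ : ψ z = 0) (hψ' : ψ' (f z) = 0)
    (hg : DifferentiableOn ℂ (ψ' ∘ f ∘ φ) (Metric.ball 0 1)) :
    HasHypDistortion f Ω Ω' z ‖deriv (ψ' ∘ f ∘ φ) 0‖ := by
  have hφ : φ 0 = z := by rw [← hψ, hR.left_inv z hz]
  have hev : ∀ᶠ x in 𝓝[≠] z, x ∈ Ω := nhdsWithin_le_nhds (hΩ.mem_nhds hz)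
  have hlim : Tendsto ψ (𝓝[≠] z) (𝓝[≠] 0) := by
    refine tendsto_nhdsWithin_iff.2 ⟨?_, ?_⟩
    · rw [← hψ]
      exact (hR.diff.continuousOn.continuousAt (hΩ.mem_nhds hz)).tendsto.mono_left
        nhdsWithin_le_nhds
    · filter_upwards [hev, self_mem_nhdsWithin] with x hx hxz h0
      exact hxz (by rw [mem_singleton_iff, ← hR.left_inv x hx, h0, hφ])
  have key := (tendsto_hypL_ratio (hg.differentiableAt (Metric.ball_mem_nhds 0 one_pos))
    (by simp [hφ, hψ'])).comp hlim
  refine key.congr' ?_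
  filter_upwards [hev] with x hx
  rw [hR'.hypDist_eq (hf hx) (hf hz), hR.hypDist_eq hx hz, hψ, hψ', mob_zero_right, mob_zero_right,
    norm_neg, norm_neg, Function.comp_apply, Function.comp_apply, Function.comp_apply,
    hR.left_inv x hx]

theorem exists_discModel {f : ℂ → ℂ} (hf : Differentiable ℂ f) (hopen : IsOpenMap f) {U : Set ℂ}
    (hU : IsWanderingDomain f U) (hsc : IsSimplyConnected U) {z : ℂ} (hz : z ∈ U) :
    ∃ g w : ℕ → ℂ → ℂ, DiscModel f U z g w := by
  have hmem : ∀ n, ∀ x ∈ U, f^[n] x ∈ fatouImage f U n := fun n x hx =>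
    iterate_mem_fatouImage hopen hU.1 hx n
  choose ψ φ hR hψ using fun n =>
    exists_isRiemannMap_fatouImage hf hopen hU hsc n (hmem n z hz)
  have hmaps : ∀ n, MapsTo f (fatouImage f U n) (fatouImage f U (n + 1)) := fun n =>
    mapsTo_fatouImage hf.continuous hopen hU.1 n 1
  have hfφ : ∀ n, MapsTo (f ∘ φ n) (Metric.ball 0 1) (fatouImage f U (n + 1)) := fun n =>
    (hmaps n).comp (hR n).mapsTo_symm
  have hdiff : ∀ n, DifferentiableOn ℂ (ψ (n + 1) ∘ f ∘ φ n) (Metric.ball 0 1) := fun n =>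
    (hR (n + 1)).diff.comp (hf.comp_differentiableOn (hR n).diff_symm) (hfφ n)
  have hφ : ∀ n, φ n 0 = f^[n] z := fun n => by rw [← hψ n, (hR n).left_inv _ (hmem n z hz)]
  refine ⟨fun n => ψ (n + 1) ∘ f ∘ φ n, fun n x => ψ n (f^[n] x), ⟨hdiff,
    fun n => (hR (n + 1)).mapsTo.comp (hfφ n), fun n => ?_,
    fun n x hx => mem_ball_zero_iff.1 ((hR n).mapsTo (hmem n x hx)), hψ, fun n x hx => ?_,
    fun n x hx y hy h => ?_, fun n x hx y hy => (hR n).hypDist_eq (hmem n x hx) (hmem n y hy),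
    fun n => ?_⟩⟩
  · simp only [Function.comp_apply]
    rw [hφ, ← Function.iterate_succ_apply' f, hψ]
  · simp only [Function.comp_apply]
    rw [(hR n).left_inv _ (hmem n x hx), ← Function.iterate_succ_apply' f]
  · rw [← (hR n).left_inv _ (hmem n x hx), ← (hR n).left_inv _ (hmem n y hy)]
    exact congrArg (φ n) h
  · refine (hR n).hasHypDistortion (hR (n + 1))
      (isFatouComponent_fatouImage hf.continuous hopen hU.1 n).isOpen (hmaps n) (hmem n z hz)
      (hψ n) ?_ (hdiff n)
    rw [← Function.iterate_succ_apply' f, hψ]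

namespace DiscModel

variable {f : ℂ → ℂ} {U : Set ℂ} {z : ℂ} {g w : ℕ → ℂ → ℂ}

theorem norm_deriv_le_one (M : DiscModel f U z g w) (n : ℕ) : ‖deriv (g n) 0‖ ≤ 1 := by
  rw [← dslope_same]
  exact norm_dslope_le_one (M.diff n) (M.mapsTo n) (M.map_zero n) (by simp)

theorem norm_step (M : DiscModel f U z g w) {x : ℂ} (hx : x ∈ U) (n : ℕ) :
    ‖w (n + 1) x‖ = ‖w n x‖ * ‖dslope (g n) 0 (w n x)‖ := by
  rw [M.step n x hx, eq_mul_dslope (M.map_zero n) (w n x), norm_mul]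

theorem norm_antitone (M : DiscModel f U z g w) {x : ℂ} (hx : x ∈ U) :
    Antitone fun n => ‖w n x‖ := by
  refine antitone_nat_of_succ_le fun n => ?_
  rw [M.norm_step hx]
  exact mul_le_of_le_one_right (norm_nonneg _)
    (norm_dslope_le_one (M.diff n) (M.mapsTo n) (M.map_zero n) (M.norm_lt n x hx))

/-- Since |w_n(x)| decreases, r = |w_0(x)| works at every time, so one constant serves all n. -/
theorem dslope_bounds (M : DiscModel f U z g w) {x : ℂ} (hx : x ∈ U) :
    ∃ c > 0, ∀ n, c * (1 - ‖deriv (g n) 0‖) ≤ 1 - ‖dslope (g n) 0 (w n x)‖ ∧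
      c * (1 - ‖dslope (g n) 0 (w n x)‖) ≤ 1 - ‖deriv (g n) 0‖ := by
  have h := M.norm_lt 0 x hx
  refine ⟨(1 - ‖w 0 x‖ ^ 2) / 4, by nlinarith [norm_nonneg (w 0 x)], fun n => ?_⟩
  exact dslope_estimates (M.diff n) (M.mapsTo n) (M.map_zero n) h (M.norm_antitone hx n.zero_le)

theorem mob_antitone (M : DiscModel f U z g w) {x y : ℂ} (hx : x ∈ U) (hy : y ∈ U) :
    Antitone fun n => ‖mob (w n x) (w n y)‖ := by
  refine antitone_nat_of_succ_le fun n => ?_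
  rw [M.step n x hx, M.step n y hy]
  exact norm_mob_le_of_mapsTo_ball (M.diff n) (M.mapsTo n) (M.norm_lt n x hx) (M.norm_lt n y hy)

theorem orbitDist_antitone (M : DiscModel f U z g w) {x y : ℂ} (hx : x ∈ U) (hy : y ∈ U) :
    Antitone fun n => orbitDist f U n x y := fun m n hmn => by
  have hmem := fun n => norm_mob_mem (M.norm_lt n x hx) (M.norm_lt n y hy)
  simp only [M.orbitDist_eq _ x hx y hy]
  exact hypL_strictMonoOn.monotoneOn (hmem n) (hmem m) (M.mob_antitone hx hy hmn)

theorem orbitDist_base (M : DiscModel f U z g w) (hz : z ∈ U) {x : ℂ} (hx : x ∈ U) (n : ℕ) :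
    orbitDist f U n z x = hypL ‖w n x‖ := by
  rw [M.orbitDist_eq n z hz x hx, M.base, norm_mob_comm, mob_zero_right, norm_neg]

theorem orbitDist_pos (M : DiscModel f U z g w) {x y : ℂ} (hx : x ∈ U) (hy : y ∈ U) {n : ℕ}
    (h : f^[n] x ≠ f^[n] y) : 0 < orbitDist f U n x y := by
  have hxn := M.norm_lt n x hx
  have hyn := M.norm_lt n y hy
  rw [M.orbitDist_eq n x hx y hy, ← hypL_zero]
  refine hypL_strictMonoOn (by simp) (norm_mob_mem hxn hyn) (norm_pos_iff.2 fun h0 => h ?_)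
  refine M.inj n x hx y hy (injOn_mob hxn (mem_ball_zero_iff.2 hxn) (mem_ball_zero_iff.2 hyn) ?_)
  rw [h0, mob_self]

/-- Every orbit is drawn to the base orbit, so divergence at the single point z controls all pairs.
-/
theorem isContracting (M : DiscModel f U z g w)
    (hsum : Tendsto (fun m => ∑ n ∈ Finset.range m, (1 - ‖deriv (g n) 0‖)) atTop atTop) :
    IsContracting f U := by
  have hw : ∀ x ∈ U, Tendsto (fun n => w n x) atTop (𝓝 0) := fun x hx => by
    obtain ⟨c, hc, hb⟩ := M.dslope_bounds hx
    exact tendsto_zero_iff_norm_tendsto_zero.2 (tendsto_zero_of_sum_tendsto_atTop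
      (fun n => norm_nonneg (w n x)) (M.norm_step hx) hc (fun n => (hb n).1) hsum)
  intro x hx y hy
  simp only [M.orbitDist_eq _ x hx y hy]
  have h1 : Tendsto (fun n => ‖mob (w n x) (w n y)‖) atTop (𝓝 0) := by
    have h2 : Tendsto (fun n => 1 - (starRingEnd ℂ) (w n x) * w n y) atTop (𝓝 1) := by
      simpa using (((Complex.continuous_conj.tendsto 0).comp (hw x hx)).mul (hw y hy)).const_sub 1
    simpa [mob] using (((hw y hy).sub (hw x hx)).div h2 one_ne_zero).norm
  have h3 := hasDerivAt_hypL_zero.continuousAt.tendsto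
  rw [hypL_zero] at h3
  exact h3.comp h1

theorem exists_tendsto_orbitDist (M : DiscModel f U z g w) {x y : ℂ} (hx : x ∈ U) (hy : y ∈ U) :
    ∃ c, Tendsto (fun n => orbitDist f U n x y) atTop (𝓝 c) ∧ ∀ n, c ≤ orbitDist f U n x y := by
  have hbdd : BddBelow (range fun n => orbitDist f U n x y) := by
    refine ⟨0, ?_⟩
    rintro _ ⟨n, rfl⟩
    have hmem := norm_mob_mem (M.norm_lt n x hx) (M.norm_lt n y hy)
    rw [← hypL_zero]
    simp only [M.orbitDist_eq _ x hx y hy]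
    exact hypL_strictMonoOn.monotoneOn (by simp) hmem hmem.1
  have h := tendsto_atTop_ciInf (M.orbitDist_antitone hx hy) hbdd
  exact ⟨_, h, fun n => ciInf_le hbdd n⟩

/-- Summability bounds the product of the factors from below only if none of them vanishes;
non-coalescence ensures this. -/
theorem exists_tendsto_pos (M : DiscModel f U z g w) (hz : z ∈ U)
    (hsum : Summable fun n => 1 - ‖deriv (g n) 0‖) {x : ℂ} (hx : x ∈ U)
    (hne : ∀ k, f^[k] z ≠ f^[k] x) :
    ∃ c > 0, Tendsto (fun n => orbitDist f U n z x) atTop (𝓝 c) ∧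
      ∀ n, c ≤ orbitDist f U n z x := by
  have hpos : ∀ n, 0 < ‖w n x‖ := fun n => norm_pos_iff.2 fun h0 =>
    hne n (M.inj n z hz x hx (by rw [M.base, h0]))
  obtain ⟨c, hc, hb⟩ := M.dslope_bounds hx
  obtain ⟨ε, hε, hle⟩ := exists_pos_le_of_summable hpos (M.norm_step hx) hc (fun n => (hb n).2)
    M.norm_deriv_le_one hsum
  obtain ⟨l, hl, hbelow⟩ := M.exists_tendsto_orbitDist hz hx
  refine ⟨l, ?_, hl, hbelow⟩
  obtain ⟨n, hn⟩ := hle.exists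
  have hε1 : ε ∈ Ico (0 : ℝ) 1 := ⟨hε.le, hn.trans_lt (M.norm_lt n x hx)⟩
  have h0 : 0 < hypL ε := by
    rw [← hypL_zero]
    exact hypL_strictMonoOn (by simp) hε1 hε
  refine h0.trans_le (ge_of_tendsto hl (hle.mono fun n hn => ?_))
  rw [M.orbitDist_base hz hx]
  exact hypL_strictMonoOn.monotoneOn hε1 ⟨norm_nonneg _, M.norm_lt n x hx⟩ hn

theorem orbitDist_succ_eq (M : DiscModel f U z g w) {n : ℕ} (h1 : ‖deriv (g n) 0‖ = 1) {x y : ℂ}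
    (hx : x ∈ U) (hy : y ∈ U) : orbitDist f U (n + 1) x y = orbitDist f U n x y := by
  rw [M.orbitDist_eq _ x hx y hy, M.orbitDist_eq _ x hx y hy, M.step n x hx, M.step n y hy,
    norm_mob_eq_of_norm_deriv_eq_one (M.diff n) (M.mapsTo n) (M.map_zero n) h1
      (M.norm_lt n x hx) (M.norm_lt n y hy)]

theorem isEventuallyIsometric (M : DiscModel f U z g w) {N : ℕ}
    (h1 : ∀ n ≥ N, ‖deriv (g n) 0‖ = 1) : IsEventuallyIsometric f U := by
  refine ⟨N + 1, N.succ_pos, fun n hn x y hxy => ?_⟩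
  obtain ⟨⟨hx, hy⟩, hE⟩ := hxy
  have hconst : ∀ m ≥ n, orbitDist f U m x y = orbitDist f U n x y := by
    intro m hm
    induction m, hm using Nat.le_induction with
    | base => rfl
    | succ m hm ih => rw [M.orbitDist_succ_eq (h1 m (by omega)) hx hy, ih]
  refine ⟨orbitDist f U n x y, M.orbitDist_pos hx hy fun h => hE ⟨⟨hx, hy⟩, n, h⟩, ?_, rfl⟩
  exact tendsto_const_nhds.congr' (eventually_atTop.2 ⟨n, fun m hm => (hconst m hm).symm⟩)

/-- One pair whose distance is preserved in a step is an equality case of the Schwarz lemma, so the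
whole step is a rotation. -/
theorem norm_deriv_eq_one (M : DiscModel f U z g w) (hz : z ∈ U) {x : ℂ} (hx : x ∈ U) {n : ℕ}
    (hne : f^[n] z ≠ f^[n] x) (h : orbitDist f U (n + 1) z x = orbitDist f U n z x) :
    ‖deriv (g n) 0‖ = 1 := by
  rw [M.orbitDist_base hz hx, M.orbitDist_base hz hx] at h
  have h1 := hypL_strictMonoOn.injOn ⟨norm_nonneg _, M.norm_lt (n + 1) x hx⟩
    ⟨norm_nonneg _, M.norm_lt n x hx⟩ h
  have hpos : ‖w n x‖ ≠ 0 := norm_ne_zero_iff.2 fun h0 =>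
    hne (M.inj n z hz x hx (by rw [M.base, h0]))
  rw [M.norm_step hx, mul_eq_left₀ hpos] at h1
  rw [← dslope_same, dslope_eq_of_norm_eq_one (M.diff n) (M.mapsTo n) (M.map_zero n)
    (M.norm_lt n x hx) h1 (by simp), h1]

end DiscModel

/-- Baire: for each k, the points coalescing with z by time k form a closed set, with empty interior
because f^k is open. This keeps the conditions on non-coalescing pairs from being vacuous. -/
theorem exists_forall_iterate_ne {f : ℂ → ℂ} (hf : Continuous f) (hopen : IsOpenMap f)
    {U : Set ℂ} (hU : IsOpen U) {z : ℂ} (hz : z ∈ U) :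
    ∃ x ∈ U, ∀ k, f^[k] z ≠ f^[k] x := by
  have hd : Dense (⋂ k, {x | f^[k] z ≠ f^[k] x}) := by
    refine dense_iInter_of_isOpen
      (fun k => isOpen_ne_fun continuous_const (hf.iterate k)) fun k => ?_
    refine dense_iff_inter_open.2 fun V hV hVne => ?_
    by_contra hcon
    have hsub : f^[k] '' V ⊆ {f^[k] z} := by
      rintro _ ⟨x, hx, rfl⟩
      by_contra h
      exact hcon ⟨x, hx, fun h' => h h'.symm⟩
    obtain ⟨x, hx⟩ := hVne
    have h1 : f^[k] '' V = {f^[k] z} :=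
      (Nonempty.subset_singleton_iff ⟨_, mem_image_of_mem _ hx⟩).1 hsub
    exact not_isOpen_singleton (f^[k] z) (h1 ▸ isOpenMap_iterate hopen k V hV)
  obtain ⟨x, hxU, hx⟩ := hd.inter_open_nonempty U hU ⟨z, hz⟩
  exact ⟨x, hxU, fun k => mem_iInter.1 hx k⟩

theorem mem_diff_coalescingPairs {f : ℂ → ℂ} {U : Set ℂ} {x y : ℂ} :
    (x, y) ∈ (U ×ˢ U) \ coalescingPairs f U ↔ x ∈ U ∧ y ∈ U ∧ ∀ k, f^[k] x ≠ f^[k] y := by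
  constructor
  · rintro ⟨⟨hx, hy⟩, hE⟩
    exact ⟨hx, hy, fun k hk => hE ⟨⟨hx, hy⟩, k, hk⟩⟩
  · rintro ⟨hx, hy, hE⟩
    exact ⟨⟨hx, hy⟩, fun h => h.2.elim fun k hk => hE k hk⟩

namespace DiscModel

variable {f : ℂ → ℂ} {U : Set ℂ} {z : ℂ} {g w : ℕ → ℂ → ℂ}

theorem isContracting_iff (M : DiscModel f U z g w) (hz : z ∈ U)
    (hx : ∃ x ∈ U, ∀ k, f^[k] z ≠ f^[k] x) : IsContracting f U ↔
      Tendsto (fun m => ∑ n ∈ Finset.range m, (1 - ‖deriv (g n) 0‖)) atTop atTop := by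
  refine ⟨fun hC => ?_, M.isContracting⟩
  by_contra hsum
  rw [← not_summable_iff_tendsto_nat_atTop_of_nonneg
    fun n => sub_nonneg.2 (M.norm_deriv_le_one n), not_not] at hsum
  obtain ⟨x, hxU, hne⟩ := hx
  obtain ⟨c, hc, hlim, -⟩ := M.exists_tendsto_pos hz hsum hxU hne
  exact hc.ne (tendsto_nhds_unique (hC z hz x hxU) hlim)

theorem isEventuallyIsometric_iff (M : DiscModel f U z g w) (hz : z ∈ U)
    (hx : ∃ x ∈ U, ∀ k, f^[k] z ≠ f^[k] x) :
    IsEventuallyIsometric f U ↔ ∃ N, ∀ n ≥ N, ‖deriv (g n) 0‖ = 1 := by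
  refine ⟨fun ⟨N, _, hN⟩ => ⟨N, fun n hn => ?_⟩, fun ⟨N, hN⟩ => M.isEventuallyIsometric hN⟩
  obtain ⟨x, hxU, hne⟩ := hx
  have hpair := mem_diff_coalescingPairs.2 ⟨hz, hxU, hne⟩
  obtain ⟨c, -, hc, hcn⟩ := hN n hn z x hpair
  obtain ⟨c', -, hc', hcn'⟩ := hN (n + 1) (by omega) z x hpair
  refine M.norm_deriv_eq_one hz hxU (hne n) ?_
  rw [hcn, hcn', tendsto_nhds_unique hc hc']

/-- Distances decrease, so once the limit is reached they are constant, and every later step is a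
rotation. -/
theorem ne_limit_of_not_isEventuallyIsometric (M : DiscModel f U z g w) (hz : z ∈ U)
    (hI : ¬ IsEventuallyIsometric f U) {x : ℂ} (hx : x ∈ U) (hne : ∀ k, f^[k] z ≠ f^[k] x) {c : ℝ}
    (hle : ∀ n, c ≤ orbitDist f U n z x) (n : ℕ) : orbitDist f U n z x ≠ c := by
  intro hn
  have hconst : ∀ m ≥ n, orbitDist f U m z x = c := fun m hm =>
    le_antisymm ((M.orbitDist_antitone hz hx hm).trans hn.le) (hle m)
  refine hI (M.isEventuallyIsometric (N := n) fun m hm => M.norm_deriv_eq_one hz hx (hne m) ?_)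
  rw [hconst m hm, hconst (m + 1) (by omega)]

end DiscModel

theorem not_isSemiContracting_of_isEventuallyIsometric {f : ℂ → ℂ} {U : Set ℂ} {x y : ℂ}
    (h : (x, y) ∈ (U ×ˢ U) \ coalescingPairs f U) (hI : IsEventuallyIsometric f U) :
    ¬ IsSemiContracting f U := by
  intro hS
  obtain ⟨N, -, hN⟩ := hI
  obtain ⟨c, -, hc, hcN⟩ := hN N le_rfl x y h
  obtain ⟨c', -, hc', hne⟩ := hS x y h
  exact hne N (hcN.trans (tendsto_nhds_unique hc hc'))

end OrbitModel

theorem theoremA (f : ℂ → ℂ) (hf : IsTranscendentalEntire f)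
    (U : Set ℂ) (hU : IsWanderingDomain f U) (hsc : IsSimplyConnected U) :
    ((IsContracting f U ∧ ¬ IsSemiContracting f U ∧ ¬ IsEventuallyIsometric f U) ∨
      (¬ IsContracting f U ∧ IsSemiContracting f U ∧ ¬ IsEventuallyIsometric f U) ∨
      (¬ IsContracting f U ∧ ¬ IsSemiContracting f U ∧ IsEventuallyIsometric f U)) ∧
    ∀ z ∈ U, ∃ lam : ℕ → ℝ,
      (∀ n, HasHypDistortion f (fatouImage f U n) (fatouImage f U (n + 1)) (f^[n] z) (lam n)) ∧
      (IsContracting f U ↔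
        Tendsto (fun m => ∑ n ∈ Finset.range m, (1 - lam n)) atTop atTop) ∧
      (IsEventuallyIsometric f U ↔ ∃ N : ℕ, ∀ n ≥ N, lam n = 1) := by
  have hopen := hf.isOpenMap
  have hpt : ∀ z ∈ U, ∃ x ∈ U, ∀ k, f^[k] z ≠ f^[k] x := fun z hz =>
    exists_forall_iterate_ne hf.1.continuous hopen hU.1.isOpen hz
  refine ⟨?_, fun z hz => ?_⟩
  · obtain ⟨z₀, hz₀⟩ := hU.1.nonempty
    obtain ⟨x₀, hx₀, hne₀⟩ := hpt z₀ hz₀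
    have hpair := mem_diff_coalescingPairs.2 ⟨hz₀, hx₀, hne₀⟩
    by_cases hC : IsContracting f U
    · have hlim := hC z₀ hz₀ x₀ hx₀
      refine Or.inl ⟨hC, fun hS => ?_, fun ⟨N, _, hN⟩ => ?_⟩
      · obtain ⟨c, hc, hc', -⟩ := hS z₀ x₀ hpair
        exact hc.ne (tendsto_nhds_unique hlim hc')
      · obtain ⟨c, hc, hc', -⟩ := hN N le_rfl z₀ x₀ hpair
        exact hc.ne (tendsto_nhds_unique hlim hc')
    · by_cases hI : IsEventuallyIsometric f U
      · exact Or.inr (Or.inr ⟨hC, not_isSemiContracting_of_isEventuallyIsometric hpair hI, hI⟩)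
      · refine Or.inr (Or.inl ⟨hC, fun z x hzx => ?_, hI⟩)
        obtain ⟨hz, hx, hne⟩ := mem_diff_coalescingPairs.1 hzx
        -- The model is based at the first point of the given pair, so only distances from the
        -- origin have to be bounded below.
        obtain ⟨g, w, M⟩ := exists_discModel hf.1 hopen hU hsc hz
        have hsum : Summable fun n => 1 - ‖deriv (g n) 0‖ := by
          by_contra h
          rw [not_summable_iff_tendsto_nat_atTop_of_nonneg
            fun n => sub_nonneg.2 (M.norm_deriv_le_one n)] at h
          exact hC (M.isContracting h)
        obtain ⟨c, hc, hlim, hle⟩ := M.exists_tendsto_pos hz hsum hx hne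
        exact ⟨c, hc, hlim, M.ne_limit_of_not_isEventuallyIsometric hz hI hx hne hle⟩
  · obtain ⟨g, w, M⟩ := exists_discModel hf.1 hopen hU hsc hz
    exact ⟨fun n => ‖deriv (g n) 0‖, M.distortion, M.isContracting_iff hz (hpt z hz),
      M.isEventuallyIsometric_iff hz (hpt z hz)⟩
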